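/- For $\lambda\ge 1$ consider functions $u(x,t)$ that are $\lambda$-periodic in $x\in\mathbb{R}/\lambda\mathbb{Z}$, $t\in\mathbb{R}$. Let $\hat u(k,t)=\int_0^\lambda e^{-2\pi i kx}u(x,t)\,dx$, $k\in\mathbb{Z}/\lambda$, be the Fourier transform in $x$, and $\tilde u(k,\tau)$ the Fourier transform in $x$ and $t$ (with $e^{-2\pi i t\tau}$ in $t$). Let $(dk)_\lambda$ be the normalized counting measure, $\int\phi(k)\,(dk)_\lambda=\frac1\lambda\sum_{k\in\mathbb{Z}/\lambda}\phi(k)$, and $\langle\cdot\rangle=1+|\cdot|$. Put $$\|u\|_{X^{s,b}}=\big\|\langle k\rangle^{s}\langle\tau-4\pi^2k^3\rangle^{b}\,\tilde u(k,\tau)\big\|_{L^2((dk)_\lambda d\tau)},$$ $$\|u\|_{Y^s}=\|u\|_{X^{s,1/2}}+\big\|\langle k\rangle^{s}\tilde u(k,\tau)\big\|_{L^2((dk)_\lambda)L^1(d\tau)},$$ $$\|u\|_{Z^s}=\|u\|_{X^{s,-1/2}}+\big\|\langle k\rangle^{s}\langle\tau-4\pi^2k^3\rangle^{-1}\tilde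 u(k,\tau)\big\|_{L^2((dk)_\lambda)L^1(d\tau)}.$$ Define $J[u,v,w]$ through its Fourier coefficients in $x$ (at each time $t$) by $$\hat J[u,v,w](k)=\frac{ik}{3}\,\frac1{\lambda^2}\sum_{\substack{k_1+k_2+k_3=k\\(k_1+k_2)(k_2+k_3)(k_3+k_1)\ne0}}\hat u(k_1)\hat v(k_2)\hat w(k_3)\;-\;\frac{ik}{\lambda^2}\,\hat u(k)\hat v(k)\hat w(-k),\qquad k,k_j\in\mathbb{Z}/\lambda .$$ **Proposition.** Let $s\ge\frac12$. For every $\varepsilon>0$ there is a constant $C=C(s,\varepsilon)>0$ such that for all $\lambda\ge1$ and all $u,v,w\in X^{s,1/2}$ which are $\lambda$-periodic in $x$, the sum defining $\hat J[u,v,w](k)$ converges absolutely for almost every $t$ and all $k$, and $$\|J[u,v,w]\|_{Z^s}\le C\,\lambda^{\varepsilon}\,\|u\|_{Y^s}\|v\|_{Y^s}\|w\|_{Y^s}$$ (the right-hand side may be infinite; as usual $0\cdot\infty=0$). -/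

import Mathlib

open MeasureTheory FourierTransform
open scoped ENNReal

noncomputable section

namespace MKdV

/-- The Japanese bracket `⟨x⟩ = 1 + |x|`. -/
def bracket (x : ℝ) : ℝ := 1 + |x|

/-- The wave number `k = n / lam ∈ ℤ / lam` with index `n`. -/
def freq (lam : ℝ) (n : ℤ) : ℝ := (n : ℝ) / lam

/-- The modulation `σ = τ - 4 π² k³`, with `k = n / lam`. -/
def modulation (lam : ℝ) (n : ℤ) (τ : ℝ) : ℝ := τ - 4 * Real.pi ^ 2 * freq lam n ^ 3

/-- The Fourier transform in `x` of a function on `(ℝ / lam ℤ) × ℝ`: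
`û(k, t) = ∫_0^lam exp(-2 π i k x) u(x, t) dx`, with `k = n / lam`. The volume on `AddCircle lam` is
Lebesgue measure, of total mass `lam`, and `fourier (-n) x = exp(-2 π i n x / lam)`. -/
def xFourier {lam : ℝ} [Fact (0 < lam)] (u : AddCircle lam × ℝ → ℂ) (n : ℤ) (t : ℝ) : ℂ :=
  ∫ x : AddCircle lam, fourier (-n) x * u (x, t)

open Classical in
/-- The (Plancherel) Fourier transform in `t` of a square integrable function of `t`, formally
`∫ exp(-2 π i t τ) f(t) dt`. Only used for `f` in `L²(ℝ)`. -/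
def tFourier (f : ℝ → ℂ) : ℝ → ℂ :=
  if h : MemLp f 2 volume then ((𝓕 (h.toLp f) : Lp ℂ 2 (volume : Measure ℝ)) : ℝ → ℂ) else 0

/-! A `lam`-periodic distribution in `x` (depending on `t`) is given by the family
`a n t = û(n / lam, t)` of its Fourier coefficients in `x`. The norms below are written for such
families, all of whose members are in `L²(dt)`; the value is `∞` for any other family.
Sums over `k ∈ ℤ / lam` carry the normalized counting measure `(dk)_lam`, i.e. a factor `1 / lam`. -/

open Classical in
/-- `‖u‖_{X^{s,b}} = ‖ ⟨k⟩^s ⟨τ - 4π²k³⟩^b ũ(k, τ) ‖_{L²((dk)_lam dτ)}`. -/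
def XNorm (lam s b : ℝ) (a : ℤ → ℝ → ℂ) : ℝ≥0∞ :=
  if ∀ n, MemLp (a n) 2 volume then
    (ENNReal.ofReal (1 / lam) * ∑' n : ℤ, ∫⁻ τ : ℝ,
      (ENNReal.ofReal (bracket (freq lam n) ^ s * bracket (modulation lam n τ) ^ b)
        * ‖tFourier (a n) τ‖ₑ) ^ 2) ^ (1 / 2 : ℝ)
  else ∞

open Classical in
/-- `‖ ⟨k⟩^s ⟨τ - 4π²k³⟩^b ũ(k, τ) ‖_{L²((dk)_lam) L¹(dτ)}`. -/
def L2L1Norm (lam s b : ℝ) (a : ℤ → ℝ → ℂ) : ℝ≥0∞ :=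
  if ∀ n, MemLp (a n) 2 volume then
    (ENNReal.ofReal (1 / lam) * ∑' n : ℤ, (∫⁻ τ : ℝ,
      ENNReal.ofReal (bracket (freq lam n) ^ s * bracket (modulation lam n τ) ^ b)
        * ‖tFourier (a n) τ‖ₑ) ^ 2) ^ (1 / 2 : ℝ)
  else ∞

/-- `‖u‖_{Y^s} = ‖u‖_{X^{s,1/2}} + ‖ ⟨k⟩^s ũ ‖_{L²((dk)_lam) L¹(dτ)}`. -/
def YNorm (lam s : ℝ) (a : ℤ → ℝ → ℂ) : ℝ≥0∞ :=
  XNorm lam s (1 / 2) a + L2L1Norm lam s 0 a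

/-- `‖u‖_{Z^s} = ‖u‖_{X^{s,-1/2}} + ‖ ⟨k⟩^s ⟨τ - 4π²k³⟩^{-1} ũ ‖_{L²((dk)_lam) L¹(dτ)}`. -/
def ZNorm (lam s : ℝ) (a : ℤ → ℝ → ℂ) : ℝ≥0∞ :=
  XNorm lam s (-(1 / 2)) a + L2L1Norm lam s (-1) a

/-- `u ∈ X^{s,b}`, for `s, b ≥ 0`: then `X^{s,b}` is a subspace of `L²((ℝ / lam ℤ) × ℝ)`. -/
def MemX {lam : ℝ} [Fact (0 < lam)] (s b : ℝ) (u : AddCircle lam × ℝ → ℂ) : Prop :=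
  MemLp u 2 volume ∧ XNorm lam s b (xFourier u) < ∞

/-- The summand of the nonresonant part of `Ĵ` at `k = n / lam`, for the wave numbers
`k₁ = m.1 / lam`, `k₂ = m.2 / lam` and `k₃ = k - k₁ - k₂`: it is `û(k₁) v̂(k₂) ŵ(k₃)` where
`(k₁ + k₂)(k₂ + k₃)(k₃ + k₁) ≠ 0`, and `0` elsewhere. -/
def nonresTerm (a b c : ℤ → ℝ → ℂ) (n : ℤ) (t : ℝ) (m : ℤ × ℤ) : ℂ :=
  if (m.1 + m.2) * (m.2 + (n - m.1 - m.2)) * ((n - m.1 - m.2) + m.1) ≠ 0 then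
    a m.1 t * b m.2 t * c (n - m.1 - m.2) t
  else 0

/-- The Fourier coefficients in `x` of `J[u, v, w]`:
`Ĵ(k) = (i k / 3) ∫_{k₁+k₂+k₃=k, (k₁+k₂)(k₂+k₃)(k₃+k₁)≠0} û(k₁) v̂(k₂) ŵ(k₃) (dk₁)_lam (dk₂)_lam
  - i k lam⁻² û(k) v̂(k) ŵ(-k)`.
The factor `lam⁻²` is that of the Fourier transform of a product of three functions on
`ℝ / lam ℤ`. -/
def Jhat {lam : ℝ} [Fact (0 < lam)] (u v w : AddCircle lam × ℝ → ℂ) (n : ℤ) (t : ℝ) : ℂ :=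
  Complex.I * (freq lam n : ℂ) / 3 *
      ((1 / (lam : ℂ) ^ 2) *
        ∑' m : ℤ × ℤ, nonresTerm (xFourier u) (xFourier v) (xFourier w) n t m)
    - Complex.I * (freq lam n : ℂ) *
      ((1 / (lam : ℂ) ^ 2) * (xFourier u n t * xFourier v n t * xFourier w (-n) t))

end MKdV

end

noncomputable section

namespace MKdV

section FourierTransform

open scoped Convolution ContDiff

/-! ### The Fourier transform on `L¹ ∩ L²` -/

/-! Write σ for the output modulation, σ_j for the input ones, k for the output frequency and R =
(k₁+k₂)(k₂+k₃)(k₃+k₁). On the Fourier side the product becomes a triple convolution in τ, and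
σ₁+σ₂+σ₃-σ = 12π²R. Hence |R|^{1/2} is controlled by modulations (`sqrt_abs_resonance_le`,
`sqrt_abs_resonance_le'`), and off resonance the output weight is traded for |R|^{-1/2} and a weight
⟨σ_j⟩^{1/2} on one input. That input is taken in L²(dτ), the other two in L¹(dτ), and Young's
inequality bounds the convolution; the Y norm contains exactly these two quantities.

What remains is Cauchy–Schwarz over (k₁,k₂), which needs a bound, uniform in k, for the sum of the
squared multiplier divided by |R|. Since 2k is the sum of the three pair sums and ⟨k⟩ ≤
⟨k_j⟩+|k-k_j|, each summand is at most `tripleWeight` (`sq_mul_bracket_div_le_tripleWeight`). That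
weight only just fails to be summable; `mul_mul_le_sum_rpow` replaces it by products of two factors
to the power 1+δ in independent variables, whose sum is O(λ^{2+2δ}). The prefactor λ⁻² and the
normalized counting measures turn this into λ^δ.

The resonant term needs no gain, because |k|⟨k⟩^{-2s} ≤ 1. The manipulations are justified by
proving that the candidate transform lies in L¹ ∩ L² and that its inverse transform is J almost
everywhere (`trilinear_estimate_aux`). -/

theorem integral_smul_fourierInv {f g : ℝ → ℂ} (hf : Integrable f) (hg : Integrable g) :
    ∫ x, 𝓕⁻ g x * f x = ∫ x, g x * 𝓕⁻ f x := by
  have h := VectorFourier.integral_fourierIntegral_smul_eq_flip (e := Real.fourierChar)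
    (L := -innerₗ ℝ) (μ := volume) (ν := volume) Real.continuous_fourierChar
    (by simp only [LinearMap.neg_apply, innerₗ_apply_apply]; fun_prop) hg hf
  simp only [VectorFourier.fourierIntegral, smul_eq_mul] at h
  simp only [Real.fourierInv_eq]
  convert h using 6 <;> first | simp [mul_comm] | rfl

/-- The `L²` inverse Fourier transform of `f ∈ L¹ ∩ L²` is given by the Fourier integral. -/
theorem fourierInv_toLp_ae_eq {f : ℝ → ℂ} (hf : Integrable f) (hf2 : MemLp f 2 volume) :
    ((𝓕⁻ (hf2.toLp f) : Lp ℂ 2 (volume : Measure ℝ)) : ℝ → ℂ) =ᵐ[volume] 𝓕⁻ f := by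
  -- Both sides are compared by testing against smooth compactly supported functions, where the L²
  -- transform is the distributional one and the Fourier integral can be moved onto the test
  -- function.
  refine ae_eq_of_integral_contDiff_smul_eq
    ((Lp.memLp _).locallyIntegrable (by norm_num)) ?_ ?_
  · have hc : Continuous (𝓕⁻ f) := by
      have h := VectorFourier.fourierIntegral_continuous (e := Real.fourierChar)
        (L := -innerₗ ℝ) (μ := volume) Real.continuous_fourierChar
        (by simp only [LinearMap.neg_apply, innerₗ_apply_apply]; fun_prop) hf
      convert h using 1
      ext x
      simp [VectorFourier.fourierIntegral, Real.fourierInv_eq]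
    exact hc.locallyIntegrable
  · intro g hg hgc
    have hg₁ : HasCompactSupport (Complex.ofRealCLM ∘ g) := hgc.comp_left rfl
    have hg₂ : ContDiff ℝ ∞ (Complex.ofRealCLM ∘ g) := by fun_prop
    set φ := hg₁.toSchwartzMap hg₂ with hφ
    have h := congrArg (fun T => T φ) (Lp.fourierInv_toTemperedDistribution_eq (hf2.toLp f))
    simp only [TemperedDistribution.fourierInv_apply, Lp.toTemperedDistribution_apply] at h
    have e1 : ∀ x, φ x = (g x : ℂ) := fun x => rfl
    simp only [e1] at h
    have e2 : ∫ x, (g x : ℂ) • 𝓕⁻ f x = ∫ x, (𝓕⁻ φ) x • (hf2.toLp f : ℝ → ℂ) x := by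
      have h1 := integral_smul_fourierInv hf φ.integrable
      simp only [e1] at h1
      simp only [smul_eq_mul]
      rw [← h1]
      refine integral_congr_ae ?_
      filter_upwards [hf2.coeFn_toLp] with x hx
      rw [hx, SchwartzMap.fourierInv_coe]
    simp only [← Complex.coe_smul]
    rw [e2, h]

/-! ### Plancherel and inversion for `tFourier`. -/

theorem tFourier_of_memLp {a : ℝ → ℂ} (ha : MemLp a 2 volume) :
    tFourier a = ((𝓕 (ha.toLp a) : Lp ℂ 2 (volume : Measure ℝ)) : ℝ → ℂ) := by
  rw [tFourier, dif_pos ha]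

theorem memLp_tFourier (a : ℝ → ℂ) : MemLp (tFourier a) 2 volume := by
  by_cases ha : MemLp a 2 volume
  · rw [tFourier_of_memLp ha]; exact Lp.memLp _
  · rw [tFourier, dif_neg ha]; exact MemLp.zero

theorem measurable_tFourier (a : ℝ → ℂ) : Measurable (tFourier a) := by
  by_cases ha : MemLp a 2 volume
  · rw [tFourier_of_memLp ha]; exact (Lp.stronglyMeasurable _).measurable
  · rw [tFourier, dif_neg ha]; exact measurable_const

theorem lintegral_enorm_sq_eq {f : ℝ → ℂ} :
    ∫⁻ x, ‖f x‖ₑ ^ 2 = eLpNorm f 2 volume ^ 2 := by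
  rw [eLpNorm_eq_lintegral_rpow_enorm_toReal (by norm_num) (by norm_num)]
  simp only [ENNReal.toReal_ofNat, ENNReal.rpow_ofNat]
  rw [← ENNReal.rpow_natCast, ← ENNReal.rpow_mul]
  norm_num

theorem memLp_two_of_lintegral_lt_top {f : ℝ → ℂ} (hf : AEStronglyMeasurable f volume)
    (h : ∫⁻ x, ‖f x‖ₑ ^ 2 < ⊤) : MemLp f 2 volume := by
  refine ⟨hf, ?_⟩
  rw [lintegral_enorm_sq_eq] at h
  exact (ENNReal.pow_lt_top_iff.1 h).resolve_right (by norm_num)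

/-- Plancherel's theorem. -/
theorem lintegral_tFourier_sq {a : ℝ → ℂ} (ha : MemLp a 2 volume) :
    ∫⁻ τ, ‖tFourier a τ‖ₑ ^ 2 = ∫⁻ t, ‖a t‖ₑ ^ 2 := by
  rw [lintegral_enorm_sq_eq, lintegral_enorm_sq_eq, tFourier_of_memLp ha, ← Lp.enorm_def,
    ← eLpNorm_congr_ae ha.coeFn_toLp, ← Lp.enorm_def]
  have := Lp.norm_fourier_eq (ha.toLp a)
  rw [← ofReal_norm, ← ofReal_norm, this]

/-- With an integrable transform, inversion holds as an honest integral, so products of coefficients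
can be computed pointwise in t. -/
theorem eq_fourierInv_tFourier {a : ℝ → ℂ} (ha : MemLp a 2 volume)
    (hi : Integrable (tFourier a)) : a =ᵐ[volume] 𝓕⁻ (tFourier a) := by
  have h := fourierInv_toLp_ae_eq hi (memLp_tFourier a)
  have e : (memLp_tFourier a).toLp (tFourier a) = 𝓕 (ha.toLp a) := by
    ext1
    refine (MemLp.coeFn_toLp _).trans ?_
    rw [tFourier_of_memLp ha]
  rw [e, fourierInv_fourier_eq] at h
  exact ha.coeFn_toLp.symm.trans h

/-- This identifies the transform of the trilinear expression without transforming a product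
directly: it suffices to exhibit G in L¹ ∩ L² with the right inverse transform. -/
theorem tFourier_ae_eq_of_ae_eq_fourierInv {a G : ℝ → ℂ} (hG : Integrable G)
    (hG2 : MemLp G 2 volume) (h : a =ᵐ[volume] 𝓕⁻ G) :
    MemLp a 2 volume ∧ tFourier a =ᵐ[volume] G := by
  have h1 := fourierInv_toLp_ae_eq hG hG2
  have h2 : a =ᵐ[volume] ((𝓕⁻ (hG2.toLp G) : Lp ℂ 2 (volume : Measure ℝ)) : ℝ → ℂ) :=
    h.trans h1.symm
  have ha : MemLp a 2 volume := (memLp_congr_ae h2).2 (Lp.memLp _)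
  refine ⟨ha, ?_⟩
  have e : ha.toLp a = 𝓕⁻ (hG2.toLp G) := by
    ext1
    exact ha.coeFn_toLp.trans h2
  rw [tFourier_of_memLp ha, e, fourier_fourierInv_eq]
  exact hG2.coeFn_toLp

theorem tFourier_ae_eq_zero {a : ℝ → ℂ} (ha : a =ᵐ[volume] 0) :
    MemLp a 2 volume ∧ tFourier a =ᵐ[volume] 0 := by
  refine tFourier_ae_eq_of_ae_eq_fourierInv (integrable_zero _ _ _) MemLp.zero (ha.trans ?_)
  refine Filter.EventuallyEq.of_eq ?_
  ext x
  simp [Real.fourierInv_eq]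

/-! ### Triple convolutions -/

/-- The convolution `f * g * h` of three complex functions. -/
def conv3 (f g h : ℝ → ℂ) : ℝ → ℂ :=
  f ⋆[ContinuousLinearMap.mul ℂ ℂ] (g ⋆[ContinuousLinearMap.mul ℂ ℂ] h)

theorem integrable_conv3 {f g h : ℝ → ℂ} (hf : Integrable f) (hg : Integrable g)
    (hh : Integrable h) : Integrable (conv3 f g h) :=
  hf.integrable_convolution _ (hg.integrable_convolution _ hh)

theorem fourierInv_conv3 {f g h : ℝ → ℂ} (hf : Integrable f) (hg : Integrable g)
    (hh : Integrable h) (t : ℝ) :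
    𝓕⁻ (conv3 f g h) t = 𝓕⁻ f t * 𝓕⁻ g t * 𝓕⁻ h t := by
  simp only [Real.fourierInv_eq_fourier_neg, conv3]
  rw [Real.fourier_mul_convolution_eq hf (hg.integrable_convolution _ hh),
    Real.fourier_mul_convolution_eq hg hh, mul_assoc]

/-- The convolution `φ * γ * η` of three nonnegative functions. -/
def lconv3 (φ γ η : ℝ → ℝ≥0∞) : ℝ → ℝ≥0∞ := φ ⋆ₗ (γ ⋆ₗ η)

theorem enorm_convolution_le (f g : ℝ → ℂ) (τ : ℝ) :
    ‖(f ⋆[ContinuousLinearMap.mul ℂ ℂ] g) τ‖ₑ ≤ ((‖f ·‖ₑ) ⋆ₗ (‖g ·‖ₑ)) τ := by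
  refine (enorm_integral_le_lintegral_enorm _).trans (le_of_eq ?_)
  simp [lconvolution_def, enorm_mul, sub_eq_neg_add]

theorem enorm_conv3_le (f g h : ℝ → ℂ) (τ : ℝ) :
    ‖conv3 f g h τ‖ₑ ≤ lconv3 (‖f ·‖ₑ) (‖g ·‖ₑ) (‖h ·‖ₑ) τ := by
  refine (enorm_convolution_le _ _ τ).trans ?_
  refine lintegral_mono fun x => ?_
  gcongr
  exact enorm_convolution_le _ _ _

end FourierTransform

/-! ### Young inequalities for nonnegative functions -/

theorem sq_lintegral_mul_le {α : Type*} [MeasurableSpace α] {μ : Measure α} {f g : α → ℝ≥0∞}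
    (hf : AEMeasurable f μ) (hg : AEMeasurable g μ) :
    (∫⁻ a, f a * g a ∂μ) ^ 2 ≤ (∫⁻ a, f a ^ 2 ∂μ) * ∫⁻ a, g a ^ 2 ∂μ := by
  have h := ENNReal.lintegral_mul_le_Lp_mul_Lq μ Real.HolderConjugate.two_two hf hg
  simp only [Pi.mul_apply, ENNReal.rpow_ofNat] at h
  calc (∫⁻ a, f a * g a ∂μ) ^ 2
      ≤ ((∫⁻ a, f a ^ 2 ∂μ) ^ (1 / 2 : ℝ) * (∫⁻ a, g a ^ 2 ∂μ) ^ (1 / 2 : ℝ)) ^ 2 := by gcongr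
    _ = _ := by
      rw [mul_pow, ← ENNReal.rpow_natCast, ← ENNReal.rpow_natCast, ← ENNReal.rpow_mul,
        ← ENNReal.rpow_mul]
      norm_num

theorem sq_tsum_mul_le {ι : Type*} (f g : ι → ℝ≥0∞) :
    (∑' i, f i * g i) ^ 2 ≤ (∑' i, f i ^ 2) * ∑' i, g i ^ 2 := by
  let _ : MeasurableSpace ι := ⊤
  have h := sq_lintegral_mul_le (μ := (Measure.count : Measure ι)) (f := f) (g := g)
    (measurable_from_top.aemeasurable) (measurable_from_top.aemeasurable)
  simpa only [lintegral_count] using h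

/-- Cauchy–Schwarz for the measure f dμ, applied to 1 and g. It yields Young's inequality L¹ * L² →
L² below. -/
theorem sq_lintegral_mul_le' {α : Type*} [MeasurableSpace α] {μ : Measure α} {f g : α → ℝ≥0∞}
    (hf : AEMeasurable f μ) (hg : AEMeasurable g μ) :
    (∫⁻ a, f a * g a ∂μ) ^ 2 ≤ (∫⁻ a, f a ∂μ) * ∫⁻ a, f a * g a ^ 2 ∂μ := by
  have h := sq_lintegral_mul_le (μ := μ) (f := fun a => f a ^ (1 / 2 : ℝ))
    (g := fun a => f a ^ (1 / 2 : ℝ) * g a) (by fun_prop) (by fun_prop)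
  have e : ∀ a, (f a ^ (1 / 2 : ℝ)) ^ 2 = f a := fun a => by
    rw [← ENNReal.rpow_natCast, ← ENNReal.rpow_mul]; norm_num
  simpa only [← mul_assoc, ← sq, e, mul_pow] using h

theorem lintegral_lconvolution {f g : ℝ → ℝ≥0∞} (hf : Measurable f) (hg : Measurable g) :
    ∫⁻ τ, (f ⋆ₗ g) τ = (∫⁻ x, f x) * ∫⁻ x, g x := by
  simp only [lconvolution_def]
  rw [lintegral_lintegral_swap (by fun_prop)]
  have : ∀ y, ∫⁻ x, f y * g (-y + x) = f y * ∫⁻ x, g x := fun y => by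
    rw [lintegral_const_mul _ (by fun_prop), lintegral_add_left_eq_self (fun x => g x)]
  simp only [this]
  rw [lintegral_mul_const _ hf]

theorem lintegral_lconvolution_sq_le {f g : ℝ → ℝ≥0∞} (hf : Measurable f) (hg : Measurable g) :
    ∫⁻ τ, (f ⋆ₗ g) τ ^ 2 ≤ (∫⁻ x, f x) ^ 2 * ∫⁻ x, g x ^ 2 := by
  have h : ∀ τ, (f ⋆ₗ g) τ ^ 2 ≤ (∫⁻ x, f x) * (f ⋆ₗ (fun x => g x ^ 2)) τ := fun τ =>
    sq_lintegral_mul_le' hf.aemeasurable (by fun_prop)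
  refine (lintegral_mono h).trans ?_
  rw [lintegral_const_mul _ (by fun_prop), lintegral_lconvolution hf (by fun_prop), ← mul_assoc, sq]

theorem measurable_lconv3 {φ γ η : ℝ → ℝ≥0∞} (hφ : Measurable φ) (hγ : Measurable γ)
    (hη : Measurable η) : Measurable (lconv3 φ γ η) := by
  unfold lconv3; fun_prop

theorem lintegral_lconv3 {φ γ η : ℝ → ℝ≥0∞} (hφ : Measurable φ) (hγ : Measurable γ)
    (hη : Measurable η) :
    ∫⁻ τ, lconv3 φ γ η τ = (∫⁻ x, φ x) * (∫⁻ x, γ x) * ∫⁻ x, η x := by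
  unfold lconv3
  rw [lintegral_lconvolution hφ (by fun_prop), lintegral_lconvolution hγ hη, mul_assoc]

/-- Lets any of the three factors be the one measured in L². -/
theorem lconv3_rotate {φ γ η : ℝ → ℝ≥0∞} (hφ : Measurable φ) (hγ : Measurable γ)
    (hη : Measurable η) : lconv3 φ γ η = lconv3 γ η φ := by
  unfold lconv3
  rw [lconvolution_comm, lconvolution_assoc hγ hη hφ]

theorem lintegral_lconv3_sq_le {φ γ η : ℝ → ℝ≥0∞} (hφ : Measurable φ) (hγ : Measurable γ)
    (hη : Measurable η) :
    ∫⁻ τ, lconv3 φ γ η τ ^ 2 ≤ (∫⁻ x, φ x) ^ 2 * (∫⁻ x, γ x) ^ 2 * ∫⁻ x, η x ^ 2 := by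
  refine (lintegral_lconvolution_sq_le hφ (by fun_prop)).trans ?_
  rw [mul_assoc]
  gcongr
  exact lintegral_lconvolution_sq_le hγ hη

theorem lconv3_eq (φ γ η : ℝ → ℝ≥0∞) (τ : ℝ) :
    lconv3 φ γ η τ = ∫⁻ x, φ x * ∫⁻ y, γ y * η (-y + (-x + τ)) := rfl

theorem lconv3_const_mul {φ γ η : ℝ → ℝ≥0∞} (hφ : Measurable φ) (hγ : Measurable γ)
    (hη : Measurable η) (a b c : ℝ≥0∞) (τ : ℝ) :
    lconv3 (fun x => a * φ x) (fun x => b * γ x) (fun x => c * η x) τ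
      = a * b * c * lconv3 φ γ η τ := by
  have e : ∀ x, ∫⁻ y, b * γ y * (c * η (-y + (-x + τ))) =
      b * c * ∫⁻ y, γ y * η (-y + (-x + τ)) := fun x => by
    rw [← lintegral_const_mul _ (by fun_prop)]
    congr 1; ext y; ring
  simp only [lconv3_eq, e]
  rw [← lintegral_const_mul _ (by fun_prop)]
  congr 1; ext x; ring

/-- Distributing a weight over the factors of a triple convolution. -/
theorem mul_lconv3_le {φ γ η b₁ b₂ b₃ : ℝ → ℝ≥0∞} (hφ : Measurable φ) (hγ : Measurable γ)
    (hη : Measurable η) (h₁ : Measurable b₁) (h₂ : Measurable b₂) (h₃ : Measurable b₃)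
    {c d e : ℝ≥0∞} {τ : ℝ}
    (h : ∀ x y z, x + y + z = τ → c ≤ e + d * (b₁ x + b₂ y + b₃ z)) :
    c * lconv3 φ γ η τ ≤ e * lconv3 φ γ η τ +
      d * (lconv3 (fun x => b₁ x * φ x) γ η τ + lconv3 φ (fun x => b₂ x * γ x) η τ
        + lconv3 φ γ (fun x => b₃ x * η x) τ) := by
  have e1 : ∀ φ γ η : ℝ → ℝ≥0∞, Measurable φ → Measurable γ → Measurable η →
      lconv3 φ γ η τ = ∫⁻ x, ∫⁻ y, φ x * (γ y * η (-y + (-x + τ))) := by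
    intro φ γ η hφ hγ hη
    rw [lconv3_eq]
    congr 1; ext x
    rw [lintegral_const_mul _ (by fun_prop)]
  rw [e1 _ _ _ hφ hγ hη, e1 _ _ _ (by fun_prop : Measurable fun x => b₁ x * φ x) hγ hη,
    e1 _ _ _ hφ (by fun_prop : Measurable fun x => b₂ x * γ x) hη,
    e1 _ _ _ hφ hγ (by fun_prop : Measurable fun x => b₃ x * η x)]
  rw [← lintegral_add_left (by fun_prop), ← lintegral_add_left (by fun_prop),
    ← lintegral_const_mul _ (by fun_prop), ← lintegral_const_mul _ (by fun_prop),
    ← lintegral_const_mul _ (by fun_prop), ← lintegral_add_left (by fun_prop)]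
  refine lintegral_mono fun x => ?_
  rw [← lintegral_add_left (by fun_prop), ← lintegral_add_left (by fun_prop),
    ← lintegral_const_mul _ (by fun_prop), ← lintegral_const_mul _ (by fun_prop),
    ← lintegral_const_mul _ (by fun_prop), ← lintegral_add_left (by fun_prop)]
  refine lintegral_mono fun y => ?_
  have h' := h x y (-y + (-x + τ)) (by ring)
  calc c * (φ x * (γ y * η (-y + (-x + τ))))
      ≤ (e + d * (b₁ x + b₂ y + b₃ (-y + (-x + τ)))) * (φ x * (γ y * η (-y + (-x + τ)))) := by
        gcongr
    _ = _ := by ring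

/-! ### Modulation weights -/

theorem bracket_pos (x : ℝ) : 0 < bracket x := by unfold bracket; positivity

theorem one_le_bracket (x : ℝ) : 1 ≤ bracket x := by
  unfold bracket; linarith [abs_nonneg x]

theorem continuous_bracket : Continuous bracket := by unfold bracket; fun_prop

theorem measurable_bracket_modulation_rpow (lam : ℝ) (n : ℤ) (b : ℝ) :
    Measurable fun τ => bracket (modulation lam n τ) ^ b := by
  have : Measurable bracket := continuous_bracket.measurable
  unfold modulation
  fun_prop

/-- The resonance function `(k₁ + k₂)(k₂ + k₃)(k₃ + k₁)`. -/
def resonance (lam : ℝ) (n₁ n₂ n₃ : ℤ) : ℝ :=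
  (freq lam n₁ + freq lam n₂) * (freq lam n₂ + freq lam n₃) * (freq lam n₃ + freq lam n₁)

theorem freq_add (lam : ℝ) (m n : ℤ) : freq lam (m + n) = freq lam m + freq lam n := by
  simp [freq, add_div]

/-- Follows from (a+b+c)³ - a³ - b³ - c³ = 3(a+b)(b+c)(c+a) and the dispersion 4π²k³; the resulting
factor 12π² exceeds 1 and is dropped. -/
theorem abs_resonance_le (lam : ℝ) (n₁ n₂ n₃ : ℤ) (x y z : ℝ) :
    |resonance lam n₁ n₂ n₃| ≤ |modulation lam (n₁ + n₂ + n₃) (x + y + z)| +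
      (|modulation lam n₁ x| + |modulation lam n₂ y| + |modulation lam n₃ z|) := by
  have e : 12 * Real.pi ^ 2 * resonance lam n₁ n₂ n₃ = modulation lam n₁ x + modulation lam n₂ y +
      modulation lam n₃ z - modulation lam (n₁ + n₂ + n₃) (x + y + z) := by
    simp only [resonance, modulation, freq_add]; ring
  have hp : 1 ≤ 12 * Real.pi ^ 2 := by nlinarith [Real.pi_gt_three]
  calc |resonance lam n₁ n₂ n₃| ≤ 12 * Real.pi ^ 2 * |resonance lam n₁ n₂ n₃| :=
        le_mul_of_one_le_left (abs_nonneg _) hp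
    _ = |12 * Real.pi ^ 2 * resonance lam n₁ n₂ n₃| := by
        rw [abs_mul, abs_of_nonneg (a := 12 * Real.pi ^ 2) (by positivity)]
    _ ≤ _ := by
        rw [e]
        refine (abs_sub _ _).trans ?_
        have := abs_add_three (modulation lam n₁ x) (modulation lam n₂ y) (modulation lam n₃ z)
        linarith

theorem sqrt_abs_resonance_le (lam : ℝ) (n₁ n₂ n₃ : ℤ) (x y z : ℝ) :
    |resonance lam n₁ n₂ n₃| ^ (1 / 2 : ℝ) ≤
      bracket (modulation lam (n₁ + n₂ + n₃) (x + y + z)) ^ (1 / 2 : ℝ) +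
      (bracket (modulation lam n₁ x) ^ (1 / 2 : ℝ) + bracket (modulation lam n₂ y) ^ (1 / 2 : ℝ)
        + bracket (modulation lam n₃ z) ^ (1 / 2 : ℝ)) := by
  have h := abs_resonance_le lam n₁ n₂ n₃ x y z
  have s : ∀ a b : ℝ, 0 ≤ a → 0 ≤ b → (a + b) ^ (1 / 2 : ℝ) ≤ a ^ (1 / 2 : ℝ) + b ^ (1 / 2 : ℝ) :=
    fun a b ha hb => Real.rpow_add_le_add_rpow ha hb (by norm_num) (by norm_num)
  have hb : ∀ x, 0 ≤ bracket x := fun x => (bracket_pos x).le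
  have hle : ∀ x, |x| ≤ bracket x := fun x => by unfold bracket; linarith
  set a := modulation lam (n₁ + n₂ + n₃) (x + y + z)
  calc _ ≤ (bracket a + (bracket (modulation lam n₁ x) + bracket (modulation lam n₂ y)
        + bracket (modulation lam n₃ z))) ^ (1 / 2 : ℝ) := by
        refine Real.rpow_le_rpow (abs_nonneg _) (h.trans ?_) (by norm_num)
        gcongr <;> exact hle _
    _ ≤ _ := by
        refine (s _ _ (hb _) (add_nonneg (add_nonneg (hb _) (hb _)) (hb _))).trans ?_
        gcongr
        refine (s _ _ (add_nonneg (hb _) (hb _)) (hb _)).trans ?_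
        gcongr
        exact s _ _ (hb _) (hb _)

theorem sqrt_abs_resonance_le' (lam : ℝ) (n₁ n₂ n₃ : ℤ) (x y z : ℝ) :
    |resonance lam n₁ n₂ n₃| ^ (1 / 2 : ℝ) ≤
      bracket (modulation lam (n₁ + n₂ + n₃) (x + y + z)) ^ (1 / 2 : ℝ) *
      (bracket (modulation lam n₁ x) ^ (1 / 2 : ℝ) + bracket (modulation lam n₂ y) ^ (1 / 2 : ℝ)
        + bracket (modulation lam n₃ z) ^ (1 / 2 : ℝ)) := by
  have h := abs_resonance_le lam n₁ n₂ n₃ x y z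
  have s : ∀ a b : ℝ, 0 ≤ a → 0 ≤ b → (a + b) ^ (1 / 2 : ℝ) ≤ a ^ (1 / 2 : ℝ) + b ^ (1 / 2 : ℝ) :=
    fun a b ha hb => Real.rpow_add_le_add_rpow ha hb (by norm_num) (by norm_num)
  have hb : ∀ x, 0 ≤ bracket x := fun x => (bracket_pos x).le
  set a := modulation lam (n₁ + n₂ + n₃) (x + y + z)
  calc _ ≤ (bracket a * (bracket (modulation lam n₁ x) + bracket (modulation lam n₂ y)
        + bracket (modulation lam n₃ z))) ^ (1 / 2 : ℝ) := by
        refine Real.rpow_le_rpow (abs_nonneg _) (h.trans ?_) (by norm_num)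
        unfold bracket
        have h0 := abs_nonneg a
        have h1 := abs_nonneg (modulation lam n₁ x)
        have h2 := abs_nonneg (modulation lam n₂ y)
        have h3 := abs_nonneg (modulation lam n₃ z)
        -- All brackets are at least 1, so the sum of the modulations is at most the product
        -- (1+|σ|)(3+|σ₁|+|σ₂|+|σ₃|).
        nlinarith [mul_nonneg h0 h1, mul_nonneg h0 h2, mul_nonneg h0 h3]
    _ ≤ _ := by
        rw [Real.mul_rpow (hb _) (add_nonneg (add_nonneg (hb _) (hb _)) (hb _))]
        gcongr
        · exact Real.rpow_nonneg (hb _) _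
        · refine (s _ _ (add_nonneg (hb _) (hb _)) (hb _)).trans ?_
          gcongr
          exact s _ _ (hb _) (hb _)

/-- `⟨σ⟩^b` with values in `[0, ∞]`. -/
def modWeight (lam : ℝ) (b : ℝ) (n : ℤ) (τ : ℝ) : ℝ≥0∞ :=
  ENNReal.ofReal (bracket (modulation lam n τ) ^ b)

theorem measurable_modWeight (lam b : ℝ) (n : ℤ) : Measurable (modWeight lam b n) :=
  (measurable_bracket_modulation_rpow lam n b).ennreal_ofReal

theorem one_le_modWeight (lam : ℝ) {b : ℝ} (hb : 0 ≤ b) (n : ℤ) (τ : ℝ) :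
    1 ≤ modWeight lam b n τ :=
  ENNReal.one_le_ofReal.2 (Real.one_le_rpow (one_le_bracket _) hb)

theorem modWeight_le_one (lam : ℝ) {b : ℝ} (hb : b ≤ 0) (n : ℤ) (τ : ℝ) :
    modWeight lam b n τ ≤ 1 :=
  ENNReal.ofReal_le_one.2 (Real.rpow_le_one_of_one_le_of_nonpos (one_le_bracket _) hb)

/-- The zero summand gives the bound the shape required by `mul_lconv3_le`. -/
theorem modWeight_neg_half_le {lam : ℝ} {n₁ n₂ n₃ : ℤ} (hr : resonance lam n₁ n₂ n₃ ≠ 0)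
    (x y z : ℝ) :
    modWeight lam (-(1 / 2)) (n₁ + n₂ + n₃) (x + y + z) ≤
      0 + ENNReal.ofReal (|resonance lam n₁ n₂ n₃| ^ (-(1 / 2) : ℝ)) *
      (modWeight lam (1 / 2) n₁ x + modWeight lam (1 / 2) n₂ y + modWeight lam (1 / 2) n₃ z) := by
  have h := sqrt_abs_resonance_le' lam n₁ n₂ n₃ x y z
  have p0 := bracket_pos (modulation lam (n₁ + n₂ + n₃) (x + y + z))
  have p1 := bracket_pos (modulation lam n₁ x)
  have p2 := bracket_pos (modulation lam n₂ y)
  have p3 := bracket_pos (modulation lam n₃ z)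
  have hp := bracket_pos
  have hr' : 0 < |resonance lam n₁ n₂ n₃| := abs_pos.2 hr
  unfold modWeight
  rw [zero_add, ← ENNReal.ofReal_add (by positivity) (by positivity),
    ← ENNReal.ofReal_add (by positivity) (by positivity),
    ← ENNReal.ofReal_mul (by positivity)]
  refine ENNReal.ofReal_le_ofReal ?_
  rw [Real.rpow_neg (hp _).le, Real.rpow_neg hr'.le]
  have h1 : 0 < bracket (modulation lam (n₁ + n₂ + n₃) (x + y + z)) ^ (1 / 2 : ℝ) :=
    Real.rpow_pos_of_pos (hp _) _
  have h2 : 0 < |resonance lam n₁ n₂ n₃| ^ (1 / 2 : ℝ) := Real.rpow_pos_of_pos hr' _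
  rw [inv_mul_eq_div, le_div_iff₀ h2, inv_mul_le_iff₀ h1]
  exact h

/-- The multiplicative bound would leave ⟨σ⟩^{-1/2}, which just misses L²(dτ). The additive bound
|R|^{1/2} ≤ ⟨σ⟩ + S, with S the sum of the ⟨σ_j⟩^{1/2}, is divided by |R|^{1/2}⟨σ⟩ instead: one term
carries no modulation weight, the other keeps the square integrable ⟨σ⟩⁻¹. -/
theorem modWeight_neg_one_le {lam : ℝ} {n₁ n₂ n₃ : ℤ} (hr : resonance lam n₁ n₂ n₃ ≠ 0)
    (x y z : ℝ) :
    modWeight lam (-1) (n₁ + n₂ + n₃) (x + y + z) ≤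
      ENNReal.ofReal (|resonance lam n₁ n₂ n₃| ^ (-(1 / 2) : ℝ)) +
      ENNReal.ofReal (|resonance lam n₁ n₂ n₃| ^ (-(1 / 2) : ℝ)) *
        modWeight lam (-1) (n₁ + n₂ + n₃) (x + y + z) *
      (modWeight lam (1 / 2) n₁ x + modWeight lam (1 / 2) n₂ y + modWeight lam (1 / 2) n₃ z) := by
  have h := sqrt_abs_resonance_le lam n₁ n₂ n₃ x y z
  have p0 := bracket_pos (modulation lam (n₁ + n₂ + n₃) (x + y + z))
  have p1 := bracket_pos (modulation lam n₁ x)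
  have p2 := bracket_pos (modulation lam n₂ y)
  have p3 := bracket_pos (modulation lam n₃ z)
  have hp := bracket_pos
  have hr' : 0 < |resonance lam n₁ n₂ n₃| := abs_pos.2 hr
  unfold modWeight
  rw [← ENNReal.ofReal_add (by positivity) (by positivity),
    ← ENNReal.ofReal_add (by positivity) (by positivity),
    ← ENNReal.ofReal_mul (by positivity), ← ENNReal.ofReal_mul (by positivity),
    ← ENNReal.ofReal_add (by positivity) (by positivity)]
  refine ENNReal.ofReal_le_ofReal ?_
  rw [Real.rpow_neg hr'.le, Real.rpow_neg_one]
  set A := bracket (modulation lam (n₁ + n₂ + n₃) (x + y + z)) with hA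
  have hA1 : 1 ≤ A := one_le_bracket _
  have h2 : 0 < |resonance lam n₁ n₂ n₃| ^ (1 / 2 : ℝ) := Real.rpow_pos_of_pos hr' _
  have h3 : A ^ (1 / 2 : ℝ) ≤ A := by
    conv_rhs => rw [← Real.rpow_one A]
    exact Real.rpow_le_rpow_of_exponent_le hA1 (by norm_num)
  set R := |resonance lam n₁ n₂ n₃| ^ (1 / 2 : ℝ)
  set S := bracket (modulation lam n₁ x) ^ (1 / 2 : ℝ) + bracket (modulation lam n₂ y) ^ (1 / 2 : ℝ)
        + bracket (modulation lam n₃ z) ^ (1 / 2 : ℝ)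
  have hA0 : 0 < A := by linarith
  have : R⁻¹ + R⁻¹ * A⁻¹ * S - A⁻¹ = R⁻¹ * A⁻¹ * (A + S - R) := by field_simp
  have : 0 ≤ R⁻¹ * A⁻¹ * (A + S - R) := mul_nonneg (by positivity) (by linarith)
  linarith

/-- The constant `∫ ⟨σ⟩^{-2} dσ`. -/
def bracketConst : ℝ≥0∞ := ∫⁻ x : ℝ, ENNReal.ofReal (bracket x ^ (-1 : ℝ)) ^ 2

theorem bracketConst_lt_top : bracketConst < ∞ := by
  have h := integrable_one_add_norm (E := ℝ) (μ := volume) (r := 2) (by norm_num)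
  have e : ∀ x, ENNReal.ofReal (bracket x ^ (-1 : ℝ)) ^ 2 =
      ENNReal.ofReal ((1 + ‖x‖) ^ (-2 : ℝ)) := fun x => by
    have := bracket_pos x
    rw [← ENNReal.ofReal_pow (by positivity), ← Real.rpow_natCast, ← Real.rpow_mul this.le]
    norm_num [bracket]
  simp only [bracketConst, e]
  exact h.lintegral_lt_top

theorem lintegral_modWeight_neg_one_sq (lam : ℝ) (n : ℤ) :
    ∫⁻ τ, modWeight lam (-1) n τ ^ 2 = bracketConst := by
  unfold modWeight modulation bracketConst
  exact lintegral_sub_right_eq_self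
    (fun x : ℝ => ENNReal.ofReal (bracket x ^ (-1 : ℝ)) ^ 2) _

/-! ### Sums over convolution constraints -/

theorem tsum_mul_eq {ι κ : Type*} (a : ι → ℝ≥0∞) (b : κ → ℝ≥0∞) :
    ∑' i, ∑' j, a i * b j = (∑' i, a i) * ∑' j, b j := by
  simp only [ENNReal.tsum_mul_left, ENNReal.tsum_mul_right]

theorem tsum_sub_left (c : ℤ → ℝ≥0∞) (n : ℤ) : ∑' j, c (n - j) = ∑' j, c j :=
  (Equiv.subLeft n).tsum_eq c

theorem tsum_fst_mul_snd (a b : ℤ → ℝ≥0∞) :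
    ∑' m : ℤ × ℤ, a m.1 * b m.2 = (∑' i, a i) * ∑' j, b j := by
  rw [ENNReal.tsum_prod (f := fun i j => a i * b j), tsum_mul_eq]

theorem tsum_fst_mul_third (a c : ℤ → ℝ≥0∞) (n : ℤ) :
    ∑' m : ℤ × ℤ, a m.1 * c (n - m.1 - m.2) = (∑' i, a i) * ∑' j, c j := by
  rw [ENNReal.tsum_prod (f := fun i j => a i * c (n - i - j))]
  simp only [ENNReal.tsum_mul_left, tsum_sub_left c, ENNReal.tsum_mul_right]

theorem tsum_snd_mul_third (b c : ℤ → ℝ≥0∞) (n : ℤ) :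
    ∑' m : ℤ × ℤ, b m.2 * c (n - m.1 - m.2) = (∑' i, b i) * ∑' j, c j := by
  rw [← tsum_fst_mul_third b c n, ← (Equiv.prodComm ℤ ℤ).tsum_eq]
  refine tsum_congr fun m => ?_
  simp [sub_right_comm]

theorem tsum_tsum_mul_mul (a b c : ℤ → ℝ≥0∞) :
    ∑' n, ∑' m : ℤ × ℤ, a m.1 * b m.2 * c (n - m.1 - m.2)
      = (∑' i, a i) * (∑' i, b i) * ∑' i, c i := by
  rw [ENNReal.tsum_comm]
  have : ∀ m : ℤ × ℤ, ∑' n, a m.1 * b m.2 * c (n - m.1 - m.2) = a m.1 * b m.2 * ∑' i, c i :=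
    fun m => by
      rw [ENNReal.tsum_mul_left, ← (Equiv.subRight (m.1 + m.2)).tsum_eq c]
      simp [sub_sub]
  simp only [this]
  rw [ENNReal.tsum_mul_right, tsum_fst_mul_snd]

/-! ### Bounds for the convolution kernel -/

/-- Since x ≤ 1 and 2δ ≤ 1, x ≤ x^{2δ}, and x^{2δ}yz = (yz)^{1-δ}(xy)^δ(xz)^δ has total degree 1+δ
in the pair products, so the largest of them dominates. This trades a logarithmic divergence for the
loss λ^ε. -/
theorem mul_mul_le_sum_rpow {x y z δ : ℝ} (hx : 0 ≤ x) (hx1 : x ≤ 1) (hy : 0 ≤ y) (hz : 0 ≤ z)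
    (hδ : 0 < δ) (hδ' : δ ≤ 1 / 2) :
    x * y * z ≤ (x * y) ^ (1 + δ) + (x * z) ^ (1 + δ) + (y * z) ^ (1 + δ) := by
  rcases hx.eq_or_lt with rfl | hx0
  · simp only [zero_mul]; positivity
  set M := max (x * y) (max (x * z) (y * z)) with hM
  have h1 : x * y ≤ M := le_max_left _ _
  have h2 : x * z ≤ M := (le_max_left _ _).trans (le_max_right _ _)
  have h3 : y * z ≤ M := (le_max_right _ _).trans (le_max_right _ _)
  have hM0 : 0 ≤ M := le_trans (by positivity) h1
  have key : x * y * z ≤ M ^ (1 + δ) := by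
    rcases hM0.eq_or_lt with h0 | hMpos
    · have : x * y = 0 := le_antisymm (h0 ▸ h1) (by positivity)
      rw [this, zero_mul]; positivity
    have hx2 : x ≤ x ^ δ * x ^ δ := by
      rw [← Real.rpow_add hx0]
      conv_lhs => rw [← Real.rpow_one x]
      exact Real.rpow_le_rpow_of_exponent_ge hx0 hx1 (by linarith)
    have e : ∀ w : ℝ, 0 ≤ w → w = w ^ (1 - δ) * w ^ δ := fun w hw => by
      rw [← Real.rpow_add_of_nonneg hw (by linarith) hδ.le]; simp
    calc x * y * z = x * (y * z) := by ring
      _ ≤ x ^ δ * x ^ δ * (y * z) := by gcongr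
      _ = x ^ δ * x ^ δ * ((y * z) ^ (1 - δ) * (y * z) ^ δ) := by
          rw [← e _ (mul_nonneg hy hz)]
      _ = (y * z) ^ (1 - δ) * ((x * y) ^ δ * (x * z) ^ δ) := by
          rw [Real.mul_rpow hy hz (z := δ), Real.mul_rpow hx hy, Real.mul_rpow hx hz]; ring
      _ ≤ M ^ (1 - δ) * (M ^ δ * M ^ δ) := by
          gcongr; linarith
      _ = M ^ (1 + δ) := by
          rw [← Real.rpow_add hMpos, ← Real.rpow_add hMpos]; congr 1; ring
  refine key.trans ?_
  have a1 : 0 ≤ (x * y) ^ (1 + δ) := by positivity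
  have a2 : 0 ≤ (x * z) ^ (1 + δ) := by positivity
  have a3 : 0 ≤ (y * z) ^ (1 + δ) := by positivity
  rcases max_choice (x * y) (max (x * z) (y * z)) with h | h
  · rw [hM, h]; linarith
  · rcases max_choice (x * z) (y * z) with h' | h' <;> rw [hM, h, h'] <;> linarith

/-! ### Pair weights and their sums. -/

theorem freq_sub (lam : ℝ) (m n : ℤ) : freq lam (m - n) = freq lam m - freq lam n := by
  simp [freq, sub_div]

/-- The weight `1 / |k - k'| + 1 / ⟨k'⟩`, without the first term if `k = k'`. -/
def pairWeight (lam : ℝ) (n j : ℤ) : ℝ := |freq lam n - freq lam j|⁻¹ + (bracket (freq lam j))⁻¹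

theorem inv_bracket_le_pairWeight (lam : ℝ) (n j : ℤ) :
    (bracket (freq lam j))⁻¹ ≤ pairWeight lam n j :=
  le_add_of_nonneg_left (by positivity)

theorem pairWeight_nonneg (lam : ℝ) (n j : ℤ) : 0 ≤ pairWeight lam n j :=
  add_nonneg (by positivity) (inv_nonneg.2 (bracket_pos _).le)

theorem pairWeight_le {lam : ℝ} (hl : 1 ≤ lam) (n j : ℤ) :
    pairWeight lam n j ≤ 2 * lam * ((1 + |((n - j : ℤ) : ℝ)|)⁻¹ + (1 + |(j : ℝ)|)⁻¹) := by
  have hl0 : 0 < lam := by linarith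
  have h1 : |freq lam n - freq lam j|⁻¹ ≤ 2 * lam * (1 + |((n - j : ℤ) : ℝ)|)⁻¹ := by
    rw [← freq_sub, freq, abs_div, abs_of_pos hl0, inv_div]
    rcases eq_or_ne (n - j) 0 with h | h
    · rw [h]; simp; positivity
    · have h1 : (1 : ℝ) ≤ |((n - j : ℤ) : ℝ)| := by
        rw [← Int.cast_abs]; exact_mod_cast Int.one_le_abs h
      rw [← div_eq_mul_inv, div_le_div_iff₀ (by linarith) (by linarith)]
      nlinarith
  have h2 : (bracket (freq lam j))⁻¹ ≤ 2 * lam * (1 + |(j : ℝ)|)⁻¹ := by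
    rw [bracket, freq, abs_div, abs_of_pos hl0, ← div_eq_mul_inv,
      inv_le_comm₀ (by positivity) (by positivity), inv_div, div_le_iff₀ (by positivity)]
    have : |(j : ℝ)| / lam * lam = |(j : ℝ)| := div_mul_cancel₀ _ hl0.ne'
    nlinarith [abs_nonneg (j : ℝ)]
  unfold pairWeight
  linarith

theorem summable_one_add_abs_rpow {θ : ℝ} (hθ : 1 < θ) :
    Summable fun j : ℤ => ((1 + |(j : ℝ)|)⁻¹) ^ θ := by
  refine Summable.of_nonneg_of_le (fun j => by positivity) (fun j => ?_)
    -- The shift by 1/2 keeps the comparison series free of vanishing denominators, and |j+1/2| ≤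
    -- 1+|j|.
    ((Real.summable_one_div_int_add_rpow (1 / 2) θ).2 hθ)
  rw [Real.inv_rpow (by positivity), one_div]
  have h0 : 0 < |(j : ℝ) + 1 / 2| := by
    rw [abs_pos]
    intro h
    have : (2 * j + 1 : ℤ) = 0 := by
      have : (2 : ℝ) * j + 1 = 0 := by linarith
      exact_mod_cast this
    omega
  gcongr
  refine (abs_add_le _ _).trans ?_
  rw [abs_of_pos (by norm_num : (0 : ℝ) < 1 / 2)]
  linarith

theorem exists_tsum_pairWeight_le {θ : ℝ} (hθ : 1 < θ) :
    ∃ C : ℝ≥0∞, C < ∞ ∧ ∀ lam : ℝ, 1 ≤ lam → ∀ n : ℤ,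
      ∑' j, ENNReal.ofReal (pairWeight lam n j ^ θ) ≤ C * ENNReal.ofReal (lam ^ θ) := by
  set z : ℤ → ℝ≥0∞ := fun j => ENNReal.ofReal (((1 + |(j : ℝ)|)⁻¹) ^ θ) with hz
  have hzf : ∑' j, z j < ∞ := (summable_one_add_abs_rpow hθ).tsum_ofReal_lt_top
  refine ⟨ENNReal.ofReal (2 ^ θ * 2 ^ θ) * (∑' j, z j + ∑' j, z j),
    ENNReal.mul_lt_top ENNReal.ofReal_lt_top (ENNReal.add_lt_top.2 ⟨hzf, hzf⟩), ?_⟩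
  intro lam hl n
  have hl0 : 0 < lam := by linarith
  have hb : ∀ j, ENNReal.ofReal (pairWeight lam n j ^ θ) ≤
      ENNReal.ofReal (2 ^ θ * 2 ^ θ) * ENNReal.ofReal (lam ^ θ) * (z (n - j) + z j) := fun j => by
    rw [hz, ← ENNReal.ofReal_mul (by positivity), ← ENNReal.ofReal_add (by positivity)
      (by positivity), ← ENNReal.ofReal_mul (by positivity)]
    refine ENNReal.ofReal_le_ofReal ?_
    set a := (1 + |((n - j : ℤ) : ℝ)|)⁻¹ with ha
    set b := (1 + |(j : ℝ)|)⁻¹ with hb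
    have ha0 : 0 ≤ a := by positivity
    have hb0 : 0 ≤ b := by positivity
    have hab : (a + b) ^ θ ≤ 2 ^ θ * (a ^ θ + b ^ θ) := by
      calc (a + b) ^ θ ≤ (2 * max a b) ^ θ := by
            gcongr
            linarith [le_max_left a b, le_max_right a b]
        _ = 2 ^ θ * (max a b) ^ θ := Real.mul_rpow (by norm_num) (le_max_of_le_left ha0)
        _ ≤ _ := by
            gcongr
            have := Real.rpow_nonneg ha0 θ
            have := Real.rpow_nonneg hb0 θ
            rcases max_choice a b with h | h <;> rw [h] <;> linarith
    calc pairWeight lam n j ^ θ ≤ (2 * lam * (a + b)) ^ θ :=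
          Real.rpow_le_rpow (pairWeight_nonneg _ _ _) (pairWeight_le hl n j) (by linarith)
      _ = 2 ^ θ * lam ^ θ * (a + b) ^ θ := by
          rw [Real.mul_rpow (by positivity) (by positivity), Real.mul_rpow (by norm_num) hl0.le]
      _ ≤ 2 ^ θ * lam ^ θ * (2 ^ θ * (a ^ θ + b ^ θ)) := by gcongr
      _ = _ := by ring
  refine (ENNReal.tsum_le_tsum hb).trans (le_of_eq ?_)
  rw [ENNReal.tsum_mul_left, ENNReal.tsum_add, tsum_sub_left z]
  ring

/-- The sum of the trilinear weights, with `x = ⟨k_j⟩⁻¹` for one `j` and `pairWeight` otherwise. -/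
def tripleWeight (lam : ℝ) (n n₁ n₂ n₃ : ℤ) : ℝ :=
  (bracket (freq lam n₁))⁻¹ * pairWeight lam n n₂ * pairWeight lam n n₃ +
  (bracket (freq lam n₂))⁻¹ * pairWeight lam n n₃ * pairWeight lam n n₁ +
  (bracket (freq lam n₃))⁻¹ * pairWeight lam n n₁ * pairWeight lam n n₂

theorem tripleWeight_le {δ : ℝ} (hδ : 0 < δ) (hδ' : δ ≤ 1 / 2) (lam : ℝ) (n n₁ n₂ n₃ : ℤ) :
    tripleWeight lam n n₁ n₂ n₃ ≤
      3 * (pairWeight lam n n₁ ^ (1 + δ) * pairWeight lam n n₂ ^ (1 + δ) +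
        pairWeight lam n n₁ ^ (1 + δ) * pairWeight lam n n₃ ^ (1 + δ) +
        pairWeight lam n n₂ ^ (1 + δ) * pairWeight lam n n₃ ^ (1 + δ)) := by
  have key : ∀ i j k : ℤ, (bracket (freq lam i))⁻¹ * pairWeight lam n j * pairWeight lam n k ≤
      pairWeight lam n i ^ (1 + δ) * pairWeight lam n j ^ (1 + δ) +
        pairWeight lam n i ^ (1 + δ) * pairWeight lam n k ^ (1 + δ) +
        pairWeight lam n j ^ (1 + δ) * pairWeight lam n k ^ (1 + δ) := by
    intro i j k
    have hx : 0 ≤ (bracket (freq lam i))⁻¹ := inv_nonneg.2 (bracket_pos _).le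
    have hi := inv_bracket_le_pairWeight lam n i
    have wi := pairWeight_nonneg lam n i
    have wj := pairWeight_nonneg lam n j
    have wk := pairWeight_nonneg lam n k
    rw [← Real.mul_rpow wi wj, ← Real.mul_rpow wi wk, ← Real.mul_rpow wj wk]
    refine (mul_mul_le_sum_rpow hx (inv_le_one_of_one_le₀ (one_le_bracket _)) wj wk hδ hδ').trans ?_
    gcongr
  have h1 := key n₁ n₂ n₃
  have h2 := key n₂ n₃ n₁
  have h3 := key n₃ n₁ n₂
  unfold tripleWeight
  nlinarith

/-- Any two of n₁, n₂, n₃ are free variables once n is fixed, so each of the three pair products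
sums to a product of two single sums, each O(λ^{1+δ}). -/
theorem exists_tsum_tripleWeight_le {δ : ℝ} (hδ : 0 < δ) (hδ' : δ ≤ 1 / 2) :
    ∃ C : ℝ≥0∞, C < ∞ ∧ ∀ lam : ℝ, 1 ≤ lam → ∀ n : ℤ,
      ∑' m : ℤ × ℤ, ENNReal.ofReal (tripleWeight lam n m.1 m.2 (n - m.1 - m.2)) ≤
        C * ENNReal.ofReal (lam ^ (2 + 2 * δ)) := by
  obtain ⟨C, hC, h⟩ := exists_tsum_pairWeight_le (θ := 1 + δ) (by linarith)
  refine ⟨9 * (C * C), ENNReal.mul_lt_top (by norm_num) (ENNReal.mul_lt_top hC hC), ?_⟩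
  intro lam hl n
  have hl0 : 0 < lam := by linarith
  set w : ℤ → ℝ≥0∞ := fun j => ENNReal.ofReal (pairWeight lam n j ^ (1 + δ)) with hw
  have hb : ∀ m : ℤ × ℤ, ENNReal.ofReal (tripleWeight lam n m.1 m.2 (n - m.1 - m.2)) ≤
      3 * (w m.1 * w m.2 + w m.1 * w (n - m.1 - m.2) + w m.2 * w (n - m.1 - m.2)) := fun m => by
    refine (ENNReal.ofReal_le_ofReal (tripleWeight_le hδ hδ' _ _ _ _ _)).trans (le_of_eq ?_)
    have w1 := pairWeight_nonneg lam n m.1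
    have w2 := pairWeight_nonneg lam n m.2
    have w3 := pairWeight_nonneg lam n (n - m.1 - m.2)
    rw [ENNReal.ofReal_mul (by norm_num), ENNReal.ofReal_add (by positivity) (by positivity),
      ENNReal.ofReal_add (by positivity) (by positivity), ENNReal.ofReal_mul (by positivity),
      ENNReal.ofReal_mul (by positivity), ENNReal.ofReal_mul (by positivity)]
    simp [hw]
  refine (ENNReal.tsum_le_tsum hb).trans ?_
  rw [ENNReal.tsum_mul_left, ENNReal.tsum_add, ENNReal.tsum_add, tsum_fst_mul_snd,
    tsum_fst_mul_third, tsum_snd_mul_third]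
  have hs := h lam hl n
  calc 3 * ((∑' i, w i) * (∑' j, w j) + (∑' i, w i) * (∑' j, w j) + (∑' i, w i) * (∑' j, w j))
      = 9 * ((∑' i, w i) * (∑' j, w j)) := by ring
    _ ≤ 9 * ((C * ENNReal.ofReal (lam ^ (1 + δ))) * (C * ENNReal.ofReal (lam ^ (1 + δ)))) := by
        gcongr
    _ = 9 * (C * C) * (ENNReal.ofReal (lam ^ (1 + δ)) * ENNReal.ofReal (lam ^ (1 + δ))) := by ring
    _ = _ := by
        rw [← ENNReal.ofReal_mul (by positivity), ← Real.rpow_add hl0]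
        congr 3; ring

/-- The pointwise bound for the multiplier at regularity `1 / 2`. -/
theorem sq_mul_bracket_div_le_tripleWeight {lam : ℝ} {n₁ n₂ n₃ : ℤ}
    (hr : resonance lam n₁ n₂ n₃ ≠ 0) :
    freq lam (n₁ + n₂ + n₃) ^ 2 * (bracket (freq lam (n₁ + n₂ + n₃)) /
      (bracket (freq lam n₁) * bracket (freq lam n₂) * bracket (freq lam n₃))) *
        |resonance lam n₁ n₂ n₃|⁻¹ ≤ tripleWeight lam (n₁ + n₂ + n₃) n₁ n₂ n₃ := by
  unfold tripleWeight pairWeight resonance at *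
  simp only [freq_add] at *
  set a := freq lam n₁
  set b := freq lam n₂
  set c := freq lam n₃
  have e1 : a + b + c - a = b + c := by ring
  have e2 : a + b + c - b = c + a := by ring
  have e3 : a + b + c - c = a + b := by ring
  rw [e1, e2, e3, abs_mul, abs_mul]
  have hP : 0 < |a + b| := abs_pos.2 (left_ne_zero_of_mul (left_ne_zero_of_mul hr))
  have hQ : 0 < |b + c| := abs_pos.2 (right_ne_zero_of_mul (left_ne_zero_of_mul hr))
  have hR : 0 < |c + a| := abs_pos.2 (right_ne_zero_of_mul hr)
  have hB := bracket_pos (a + b + c)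
  have hA1 := bracket_pos a
  have hA2 := bracket_pos b
  have hA3 := bracket_pos c
  have hkB : |a + b + c| ≤ bracket (a + b + c) := by unfold bracket; linarith
  -- The three pair sums add up to twice the output frequency; the gain of 1/2 is not kept.
  have hk : |a + b + c| ≤ |a + b| + |b + c| + |c + a| := by
    have h := abs_add_three (a + b) (b + c) (c + a)
    have e : a + b + (b + c) + (c + a) = 2 * (a + b + c) := by ring
    rw [e, abs_mul, abs_two] at h
    linarith [abs_nonneg (a + b + c)]
  have t : ∀ x y : ℝ, bracket (x + y) ≤ bracket x + |y| := fun x y => by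
    unfold bracket; linarith [abs_add_le x y]
  -- Partial fractions: a factor ⟨k⟩ over ⟨k_j⟩|k-k_j| becomes the pair weight.
  have W : ∀ x y B : ℝ, 0 < |y| → 0 < bracket x → B ≤ bracket x + |y| →
      B * ((bracket x)⁻¹ * |y|⁻¹) ≤ |y|⁻¹ + (bracket x)⁻¹ := fun x y B hy hx hB => by
    have : |y|⁻¹ + (bracket x)⁻¹ = (bracket x + |y|) * ((bracket x)⁻¹ * |y|⁻¹) := by
      field_simp
    rw [this]; gcongr
  have W1 := W a (b + c) (bracket (a + b + c)) hQ hA1 (by rw [add_assoc]; exact t a (b + c))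
  have W2 := W b (c + a) (bracket (a + b + c)) hR hA2 (by
    rw [show a + b + c = b + (c + a) by ring]; exact t b (c + a))
  have W3 := W c (a + b) (bracket (a + b + c)) hP hA3 (by
    rw [show a + b + c = c + (a + b) by ring]; exact t c (a + b))
  generalize |b + c|⁻¹ + (bracket a)⁻¹ = w1 at *
  generalize |c + a|⁻¹ + (bracket b)⁻¹ = w2 at *
  generalize |a + b|⁻¹ + (bracket c)⁻¹ = w3 at *
  rw [← sq_abs (a + b + c)]
  have hk0 : 0 ≤ |a + b + c| := abs_nonneg _
  generalize |a + b + c| = k at *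
  generalize bracket (a + b + c) = B at *
  generalize bracket a = A1 at *
  generalize bracket b = A2 at *
  generalize bracket c = A3 at *
  generalize |a + b| = P at *
  generalize |b + c| = Q at *
  generalize |c + a| = R at *
  have hw1 : 0 ≤ w1 := le_trans (by positivity) W1
  have hw2 : 0 ≤ w2 := le_trans (by positivity) W2
  have hw3 : 0 ≤ w3 := le_trans (by positivity) W3
  calc k ^ 2 * (B / (A1 * A2 * A3)) * (P * Q * R)⁻¹
      = k * k * (B / (A1 * A2 * A3)) * (P * Q * R)⁻¹ := by ring
    -- One k is spent on P+Q+R, cancelling one resonance factor per term; the other becomes a second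
    -- ⟨k⟩, one for each of the two remaining factors.
    _ ≤ (P + Q + R) * B * (B / (A1 * A2 * A3)) * (P * Q * R)⁻¹ := by gcongr
    _ = A1⁻¹ * (B * (A2⁻¹ * R⁻¹)) * (B * (A3⁻¹ * P⁻¹)) +
        A2⁻¹ * (B * (A3⁻¹ * P⁻¹)) * (B * (A1⁻¹ * Q⁻¹)) +
        A3⁻¹ * (B * (A1⁻¹ * Q⁻¹)) * (B * (A2⁻¹ * R⁻¹)) := by
        field_simp; ring
    _ ≤ _ := by gcongr

/-- The convolution kernel `|k| ⟨k⟩^s (⟨k₁⟩⟨k₂⟩⟨k₃⟩)^{-s}`. -/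
def multiplier (lam s : ℝ) (n₁ n₂ n₃ : ℤ) : ℝ :=
  |freq lam (n₁ + n₂ + n₃)| * (bracket (freq lam (n₁ + n₂ + n₃)) /
      (bracket (freq lam n₁) * bracket (freq lam n₂) * bracket (freq lam n₃))) ^ s

/-! ### Multiplier bounds for s ≥ 1/2. -/

theorem bracket_add_le (x y : ℝ) : bracket (x + y) ≤ bracket x * bracket y := by
  unfold bracket
  nlinarith [abs_add_le x y, mul_nonneg (abs_nonneg x) (abs_nonneg y)]

theorem bracket_div_nonneg (lam : ℝ) (n n₁ n₂ n₃ : ℤ) : 0 ≤ bracket (freq lam n) /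
      (bracket (freq lam n₁) * bracket (freq lam n₂) * bracket (freq lam n₃)) := by
  have h := bracket_pos (freq lam n)
  have h1 := bracket_pos (freq lam n₁)
  have h2 := bracket_pos (freq lam n₂)
  have h3 := bracket_pos (freq lam n₃)
  positivity

theorem bracket_div_le_one (lam : ℝ) (n₁ n₂ n₃ : ℤ) : bracket (freq lam (n₁ + n₂ + n₃)) /
      (bracket (freq lam n₁) * bracket (freq lam n₂) * bracket (freq lam n₃)) ≤ 1 := by
  have h1 := bracket_pos (freq lam n₁)
  have h2 := bracket_pos (freq lam n₂)
  have h3 := bracket_pos (freq lam n₃)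
  rw [div_le_one (by positivity), freq_add, freq_add]
  refine (bracket_add_le _ _).trans ?_
  gcongr
  exact bracket_add_le _ _

/-- Reduces every s ≥ 1/2 to the endpoint, as the bracket quotients are at most 1. -/
theorem sq_rpow_le {x s : ℝ} (hx : 0 ≤ x) (hx1 : x ≤ 1) (hs : 1 / 2 ≤ s) : (x ^ s) ^ 2 ≤ x := by
  rw [← Real.rpow_natCast, ← Real.rpow_mul hx]
  rcases hx.eq_or_lt with rfl | h
  · rw [Real.zero_rpow (by norm_num; linarith)]
  · conv_rhs => rw [← Real.rpow_one x]
    exact Real.rpow_le_rpow_of_exponent_ge h hx1 (by norm_num; linarith)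

theorem multiplier_nonneg (lam s : ℝ) (n₁ n₂ n₃ : ℤ) : 0 ≤ multiplier lam s n₁ n₂ n₃ :=
  mul_nonneg (abs_nonneg _) (Real.rpow_nonneg (bracket_div_nonneg _ _ _ _ _) _)

theorem sq_multiplier_mul_resonance_le {lam s : ℝ} (hs : 1 / 2 ≤ s) {n₁ n₂ n₃ : ℤ}
    (hr : resonance lam n₁ n₂ n₃ ≠ 0) :
    (multiplier lam s n₁ n₂ n₃ * |resonance lam n₁ n₂ n₃| ^ (-(1 / 2) : ℝ)) ^ 2 ≤
      tripleWeight lam (n₁ + n₂ + n₃) n₁ n₂ n₃ := by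
  refine le_trans ?_ (sq_mul_bracket_div_le_tripleWeight hr)
  have e : (|resonance lam n₁ n₂ n₃| ^ (-(1 / 2) : ℝ)) ^ 2 = |resonance lam n₁ n₂ n₃|⁻¹ := by
    rw [← Real.rpow_natCast, ← Real.rpow_mul (abs_nonneg _), ← Real.rpow_neg_one]
    norm_num
  rw [mul_pow, e, multiplier, mul_pow, sq_abs]
  gcongr
  exact sq_rpow_le (bracket_div_nonneg _ _ _ _ _) (bracket_div_le_one _ _ _ _) hs

/-- The multiplier of the resonant term is bounded. -/
theorem multiplier_neg_le_one {lam s : ℝ} (hs : 1 / 2 ≤ s) (n : ℤ) :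
    multiplier lam s n n (-n) ≤ 1 := by
  have hb := bracket_pos (freq lam n)
  have h1 := one_le_bracket (freq lam n)
  have e : bracket (freq lam (-n)) = bracket (freq lam n) := by simp [freq, bracket, neg_div]
  have hk : |freq lam n| ≤ bracket (freq lam n) := by unfold bracket; linarith
  have e2 : bracket (freq lam n) / (bracket (freq lam n) * bracket (freq lam n) *
      bracket (freq lam n)) = bracket (freq lam n) ^ (-2 : ℝ) := by
    rw [Real.rpow_neg hb.le, Real.rpow_two]; field_simp
  rw [multiplier, show n + n + -n = n by ring, e, e2, ← Real.rpow_mul hb.le]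
  calc |freq lam n| * bracket (freq lam n) ^ (-2 * s)
      ≤ bracket (freq lam n) * bracket (freq lam n) ^ (-1 : ℝ) := by
        gcongr
        linarith
    _ = 1 := by rw [Real.rpow_neg_one]; exact mul_inv_cancel₀ hb.ne'

/-- Serves the qualitative convergence statements, where no resonance gain is used: ⟨k_j⟩⁻¹ is part
of the pair weight, so the first summand of `tripleWeight` suffices. -/
theorem sq_inv_bracket_rpow_le {lam s : ℝ} (hs : 1 / 2 ≤ s) (n n₁ n₂ n₃ : ℤ) :
    ((bracket (freq lam n₁) * bracket (freq lam n₂) * bracket (freq lam n₃)) ^ (-s)) ^ 2 ≤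
      tripleWeight lam n n₁ n₂ n₃ := by
  have p1 := bracket_pos (freq lam n₁)
  have p2 := bracket_pos (freq lam n₂)
  have p3 := bracket_pos (freq lam n₃)
  have w1 := pairWeight_nonneg lam n n₁
  have w2 := pairWeight_nonneg lam n n₂
  have w3 := pairWeight_nonneg lam n n₃
  have q1 := inv_le_one_of_one_le₀ (one_le_bracket (freq lam n₁))
  have q2 := inv_le_one_of_one_le₀ (one_le_bracket (freq lam n₂))
  have q3 := inv_le_one_of_one_le₀ (one_le_bracket (freq lam n₃))
  rw [Real.rpow_neg (by positivity), ← Real.inv_rpow (by positivity)]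
  refine (sq_rpow_le (by positivity) ?_ hs).trans ?_
  · rw [mul_inv, mul_inv]
    exact mul_le_one₀ (mul_le_one₀ q1 (by positivity) q2) (by positivity) q3
  · rw [mul_inv, mul_inv, tripleWeight, add_assoc]
    refine le_add_of_le_of_nonneg ?_ (by positivity)
    gcongr <;> exact inv_bracket_le_pairWeight _ _ _

section TrilinearEstimate

/-! ### The trilinear estimate for nonnegative functions -/

/-- The square of the `Y`-type norm of the `n`-th Fourier coefficient. -/
def energy (lam : ℝ) (n : ℤ) (φ : ℝ → ℝ≥0∞) : ℝ≥0∞ :=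
  (∫⁻ τ, φ τ) ^ 2 + ∫⁻ τ, (modWeight lam (1 / 2) n τ * φ τ) ^ 2

theorem sq_lintegral_le_energy (lam : ℝ) (n : ℤ) (φ : ℝ → ℝ≥0∞) :
    (∫⁻ τ, φ τ) ^ 2 ≤ energy lam n φ := le_self_add

theorem lintegral_modWeight_sq_le_energy (lam : ℝ) (n : ℤ) (φ : ℝ → ℝ≥0∞) :
    ∫⁻ τ, (modWeight lam (1 / 2) n τ * φ τ) ^ 2 ≤ energy lam n φ := le_add_self

theorem lintegral_sq_le_energy (lam : ℝ) (n : ℤ) (φ : ℝ → ℝ≥0∞) :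
    ∫⁻ τ, φ τ ^ 2 ≤ energy lam n φ := by
  refine le_trans (lintegral_mono fun τ => ?_) (lintegral_modWeight_sq_le_energy lam n φ)
  gcongr
  exact le_mul_of_one_le_left zero_le (one_le_modWeight lam (by norm_num) n τ)

/-- The sum of the triple convolutions in which one factor is weighted by `⟨σ⟩^{1/2}`. -/
def weightedConv (lam : ℝ) (n₁ n₂ n₃ : ℤ) (φ γ η : ℝ → ℝ≥0∞) (τ : ℝ) : ℝ≥0∞ :=
  lconv3 (fun x => modWeight lam (1 / 2) n₁ x * φ x) γ η τ +
    lconv3 φ (fun x => modWeight lam (1 / 2) n₂ x * γ x) η τ +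
    lconv3 φ γ (fun x => modWeight lam (1 / 2) n₃ x * η x) τ

theorem add_sq_le (a b : ℝ≥0∞) : (a + b) ^ 2 ≤ 2 * (a ^ 2 + b ^ 2) := by
  have h := ENNReal.rpow_add_le_mul_rpow_add_rpow a b (p := 2) (by norm_num)
  norm_num at h
  exact h

variable {lam : ℝ} {n₁ n₂ n₃ : ℤ} {φ γ η : ℝ → ℝ≥0∞}

theorem measurable_weightedConv (hφ : Measurable φ) (hγ : Measurable γ) (hη : Measurable η) :
    Measurable (weightedConv lam n₁ n₂ n₃ φ γ η) := by
  have b := measurable_modWeight lam (1 / 2)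
  exact ((measurable_lconv3 ((b n₁).mul hφ) hγ hη).add
    (measurable_lconv3 hφ ((b n₂).mul hγ) hη)).add (measurable_lconv3 hφ hγ ((b n₃).mul hη))

theorem sq_lintegral_lconv3_le_energy (hφ : Measurable φ) (hγ : Measurable γ) (hη : Measurable η) :
    (∫⁻ τ, lconv3 φ γ η τ) ^ 2 ≤ energy lam n₁ φ * energy lam n₂ γ * energy lam n₃ η := by
  rw [lintegral_lconv3 hφ hγ hη, mul_pow, mul_pow]
  gcongr <;> exact sq_lintegral_le_energy _ _ _

theorem lintegral_lconv3_sq_le_energy (hφ : Measurable φ) (hγ : Measurable γ) (hη : Measurable η) :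
    ∫⁻ τ, lconv3 φ γ η τ ^ 2 ≤ energy lam n₁ φ * energy lam n₂ γ * energy lam n₃ η := by
  refine (lintegral_lconv3_sq_le hφ hγ hη).trans ?_
  gcongr
  · exact sq_lintegral_le_energy _ _ _
  · exact sq_lintegral_le_energy _ _ _
  · exact lintegral_sq_le_energy _ _ _

/-- In each summand the weighted factor is rotated into the L² slot of Young's inequality. The
constant is 4+4+2, from splitting the square of a sum of three terms. -/
theorem lintegral_weightedConv_sq_le (hφ : Measurable φ) (hγ : Measurable γ) (hη : Measurable η) :
    ∫⁻ τ, weightedConv lam n₁ n₂ n₃ φ γ η τ ^ 2 ≤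
      10 * (energy lam n₁ φ * energy lam n₂ γ * energy lam n₃ η) := by
  have b := measurable_modWeight lam (1 / 2)
  have m1 : Measurable (lconv3 (fun x => modWeight lam (1 / 2) n₁ x * φ x) γ η) :=
    measurable_lconv3 ((b n₁).mul hφ) hγ hη
  have m2 : Measurable (lconv3 φ (fun x => modWeight lam (1 / 2) n₂ x * γ x) η) :=
    measurable_lconv3 hφ ((b n₂).mul hγ) hη
  have m3 : Measurable (lconv3 φ γ (fun x => modWeight lam (1 / 2) n₃ x * η x)) :=
    measurable_lconv3 hφ hγ ((b n₃).mul hη)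
  have h3 := lintegral_lconv3_sq_le hφ hγ ((b n₃).mul hη)
  have h2 := lintegral_lconv3_sq_le hη hφ ((b n₂).mul hγ)
  have h1 := lintegral_lconv3_sq_le hγ hη ((b n₁).mul hφ)
  rw [lconv3_rotate hη hφ ((b n₂).mul hγ)] at h2
  rw [← lconv3_rotate ((b n₁).mul hφ) hγ hη] at h1
  set E := energy lam n₁ φ * energy lam n₂ γ * energy lam n₃ η with hE
  have f1 := sq_lintegral_le_energy lam n₁ φ
  have f2 := sq_lintegral_le_energy lam n₂ γ
  have f3 := sq_lintegral_le_energy lam n₃ η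
  have g1 := lintegral_modWeight_sq_le_energy lam n₁ φ
  have g2 := lintegral_modWeight_sq_le_energy lam n₂ γ
  have g3 := lintegral_modWeight_sq_le_energy lam n₃ η
  replace h1 : _ ≤ E := h1.trans (by
    rw [hE, mul_assoc (energy lam n₁ φ), mul_comm (energy lam n₁ φ)]; gcongr; exact g1)
  replace h2 : _ ≤ E := h2.trans (by
    rw [hE, mul_assoc (energy lam n₁ φ), mul_comm (energy lam n₂ γ), ← mul_assoc,
      mul_comm (energy lam n₁ φ)]; gcongr; exact g2)
  replace h3 : _ ≤ E := h3.trans (by rw [hE]; gcongr; exact g3)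
  have p : ∀ x y z : ℝ≥0∞, (x + y + z) ^ 2 ≤ 4 * x ^ 2 + 4 * y ^ 2 + 2 * z ^ 2 := fun x y z => by
    calc (x + y + z) ^ 2 ≤ 2 * ((x + y) ^ 2 + z ^ 2) := add_sq_le _ _
      _ ≤ 2 * (2 * (x ^ 2 + y ^ 2) + z ^ 2) := by gcongr; exact add_sq_le _ _
      _ = _ := by ring
  refine (lintegral_mono fun τ => p _ _ _).trans ?_
  rw [lintegral_add_left (by fun_prop), lintegral_add_left (by fun_prop), lintegral_const_mul _ (m1.pow_const 2),
    lintegral_const_mul _ (m2.pow_const 2), lintegral_const_mul _ (m3.pow_const 2)]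
  calc _ ≤ 4 * E + 4 * E + 2 * E := by gcongr <;> assumption
    _ = 10 * E := by ring

theorem sq_lintegral_add_weightedConv_le (hφ : Measurable φ) (hγ : Measurable γ)
    (hη : Measurable η) (n : ℤ) :
    (∫⁻ τ, (lconv3 φ γ η τ + modWeight lam (-1) n τ * weightedConv lam n₁ n₂ n₃ φ γ η τ)) ^ 2 ≤
      (2 + 20 * bracketConst) * (energy lam n₁ φ * energy lam n₂ γ * energy lam n₃ η) := by
  rw [lintegral_add_left (measurable_lconv3 hφ hγ hη)]
  have h := sq_lintegral_mul_le (μ := volume) (measurable_modWeight lam (-1) n).aemeasurable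
    (measurable_weightedConv (lam := lam) (n₁ := n₁) (n₂ := n₂) (n₃ := n₃) hφ hγ hη).aemeasurable
  rw [lintegral_modWeight_neg_one_sq] at h
  have h' := h.trans (mul_le_mul_right (lintegral_weightedConv_sq_le hφ hγ hη) _)
  refine (add_sq_le _ _).trans ?_
  refine (mul_le_mul_right (add_le_add (sq_lintegral_lconv3_le_energy (n₁ := n₁) (n₂ := n₂)
    (n₃ := n₃) (lam := lam) hφ hγ hη) h') _).trans (le_of_eq ?_)
  ring

/-! ### Summation over the spatial frequencies by Cauchy–Schwarz. -/

theorem lintegral_tsum_mul_sq_le {ι : Type*} [Countable ι] (K D : ι → ℝ≥0∞)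
    {S : ι → ℝ → ℝ≥0∞} (hS : ∀ i, Measurable (S i)) (h : ∀ i, ∫⁻ τ, S i τ ^ 2 ≤ D i) :
    ∫⁻ τ, (∑' i, K i * S i τ) ^ 2 ≤ (∑' i, K i ^ 2) * ∑' i, D i := by
  refine (lintegral_mono fun τ => sq_tsum_mul_le K fun i => S i τ).trans ?_
  rw [lintegral_const_mul _ (Measurable.tsum fun i => (hS i).pow_const 2),
    lintegral_tsum fun i => ((hS i).pow_const 2).aemeasurable]
  gcongr with i
  exact h i

theorem sq_lintegral_tsum_mul_le {ι : Type*} [Countable ι] (K D : ι → ℝ≥0∞)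
    {S : ι → ℝ → ℝ≥0∞} (hS : ∀ i, Measurable (S i)) (h : ∀ i, (∫⁻ τ, S i τ) ^ 2 ≤ D i) :
    (∫⁻ τ, ∑' i, K i * S i τ) ^ 2 ≤ (∑' i, K i ^ 2) * ∑' i, D i := by
  rw [lintegral_tsum fun i => ((hS i).const_mul _).aemeasurable]
  simp only [lintegral_const_mul _ (hS _)]
  refine (sq_tsum_mul_le K fun i => ∫⁻ τ, S i τ).trans ?_
  gcongr with i
  exact h i

/-- The multiplier restricted to nonresonant frequencies. -/
def nonresMultiplier (lam s : ℝ) (n : ℤ) (m : ℤ × ℤ) : ℝ≥0∞ :=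
  if (m.1 + m.2) * (m.2 + (n - m.1 - m.2)) * ((n - m.1 - m.2) + m.1) ≠ 0 then
    ENNReal.ofReal (multiplier lam s m.1 m.2 (n - m.1 - m.2)) else 0

/-- The multiplier after the gain of the square root of the resonance function. -/
def gainedMultiplier (lam s : ℝ) (n : ℤ) (m : ℤ × ℤ) : ℝ≥0∞ :=
  if (m.1 + m.2) * (m.2 + (n - m.1 - m.2)) * ((n - m.1 - m.2) + m.1) ≠ 0 then
    ENNReal.ofReal (multiplier lam s m.1 m.2 (n - m.1 - m.2) *
      |resonance lam m.1 m.2 (n - m.1 - m.2)| ^ (-(1 / 2) : ℝ)) else 0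

theorem resonance_ne_zero (hl : 0 < lam) (h : (n₁ + n₂) * (n₂ + n₃) * (n₃ + n₁) ≠ 0) :
    resonance lam n₁ n₂ n₃ ≠ 0 := by
  have e : resonance lam n₁ n₂ n₃ = ((n₁ + n₂) * (n₂ + n₃) * (n₃ + n₁) : ℤ) / lam ^ 3 := by
    simp only [resonance, freq]; push_cast; field_simp
  rw [e]
  exact div_ne_zero (by exact_mod_cast h) (by positivity)

theorem sum_eq (n : ℤ) (m : ℤ × ℤ) : m.1 + m.2 + (n - m.1 - m.2) = n := by ring

theorem sq_gainedMultiplier_le (hl : 0 < lam) {s : ℝ} (hs : 1 / 2 ≤ s) (n : ℤ) (m : ℤ × ℤ) :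
    gainedMultiplier lam s n m ^ 2 ≤
      ENNReal.ofReal (tripleWeight lam n m.1 m.2 (n - m.1 - m.2)) := by
  unfold gainedMultiplier
  split_ifs with h
  · have h' := sq_multiplier_mul_resonance_le hs (resonance_ne_zero hl h)
    rw [sum_eq] at h'
    rw [← ENNReal.ofReal_pow (mul_nonneg (multiplier_nonneg _ _ _ _ _) (by positivity))]
    exact ENNReal.ofReal_le_ofReal h'
  · simp

theorem modWeight_neg_half_mul_le (hl : 0 < lam) (s : ℝ) (n : ℤ) (m : ℤ × ℤ) (hφ : Measurable φ)
    (hγ : Measurable γ) (hη : Measurable η) (τ : ℝ) :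
    modWeight lam (-(1 / 2)) n τ * (nonresMultiplier lam s n m * lconv3 φ γ η τ) ≤
      gainedMultiplier lam s n m * weightedConv lam m.1 m.2 (n - m.1 - m.2) φ γ η τ := by
  unfold nonresMultiplier gainedMultiplier
  split_ifs with h
  · have b := measurable_modWeight lam (1 / 2)
    have key := mul_lconv3_le (c := modWeight lam (-(1 / 2)) n τ) (τ := τ) hφ hγ hη (b m.1) (b m.2)
      (b (n - m.1 - m.2)) (fun x y z hxyz => by
        have h' := modWeight_neg_half_le (resonance_ne_zero hl h) x y z
        rwa [sum_eq, hxyz] at h')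
    rw [zero_mul, zero_add] at key
    rw [mul_left_comm, ENNReal.ofReal_mul (multiplier_nonneg _ _ _ _ _), mul_assoc]
    exact mul_le_mul_right key _
  · simp

theorem modWeight_neg_one_mul_le (hl : 0 < lam) (s : ℝ) (n : ℤ) (m : ℤ × ℤ) (hφ : Measurable φ)
    (hγ : Measurable γ) (hη : Measurable η) (τ : ℝ) :
    modWeight lam (-1) n τ * (nonresMultiplier lam s n m * lconv3 φ γ η τ) ≤
      gainedMultiplier lam s n m * (lconv3 φ γ η τ +
        modWeight lam (-1) n τ * weightedConv lam m.1 m.2 (n - m.1 - m.2) φ γ η τ) := by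
  unfold nonresMultiplier gainedMultiplier
  split_ifs with h
  · have b := measurable_modWeight lam (1 / 2)
    have key := mul_lconv3_le (c := modWeight lam (-1) n τ) (τ := τ) hφ hγ hη (b m.1) (b m.2)
      (b (n - m.1 - m.2)) (fun x y z hxyz => by
        have h' := modWeight_neg_one_le (resonance_ne_zero hl h) x y z
        rwa [sum_eq, hxyz] at h')
    rw [mul_left_comm, ENNReal.ofReal_mul (multiplier_nonneg _ _ _ _ _), mul_assoc]
    refine mul_le_mul_right (key.trans (le_of_eq ?_)) _
    rw [weightedConv]; ring
  · simp

variable {Φ Γ H : ℤ → ℝ → ℝ≥0∞}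

/-- The majorant of the Fourier transform of the trilinear expression. -/
def majorant (lam s : ℝ) (Φ Γ H : ℤ → ℝ → ℝ≥0∞) (n : ℤ) (τ : ℝ) : ℝ≥0∞ :=
  ∑' m : ℤ × ℤ, nonresMultiplier lam s n m * lconv3 (Φ m.1) (Γ m.2) (H (n - m.1 - m.2)) τ +
    ENNReal.ofReal (multiplier lam s n n (-n)) * lconv3 (Φ n) (Γ n) (H (-n)) τ

theorem tsum_mul_mul_neg_le (a b c : ℤ → ℝ≥0∞) :
    ∑' n, a n * b n * c (-n) ≤ (∑' i, a i) * (∑' i, b i) * ∑' i, c i := by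
  rw [← ENNReal.tsum_mul_right, ← ENNReal.tsum_mul_right]
  gcongr with n
  · exact ENNReal.le_tsum n
  · exact ENNReal.le_tsum (-n)

/-- For fixed n, Cauchy–Schwarz in m separates the squared kernel, bounded uniformly in n, from
products of energies; summing these over n as well decouples them into three full sums. -/
theorem exists_lintegral_majorant_le {δ : ℝ} (hδ : 0 < δ) (hδ' : δ ≤ 1 / 2) :
    ∃ C : ℝ≥0∞, C < ∞ ∧ ∀ lam s : ℝ, 1 ≤ lam → 1 / 2 ≤ s → ∀ Φ Γ H : ℤ → ℝ → ℝ≥0∞,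
      (∀ n, Measurable (Φ n)) → (∀ n, Measurable (Γ n)) → (∀ n, Measurable (H n)) →
      (∑' n, ∫⁻ τ, (modWeight lam (-(1 / 2)) n τ * majorant lam s Φ Γ H n τ) ^ 2 ≤
        C * ENNReal.ofReal (lam ^ (2 + 2 * δ)) * ((∑' n, energy lam n (Φ n)) *
          (∑' n, energy lam n (Γ n)) * ∑' n, energy lam n (H n))) ∧
      (∑' n, (∫⁻ τ, modWeight lam (-1) n τ * majorant lam s Φ Γ H n τ) ^ 2 ≤
        C * ENNReal.ofReal (lam ^ (2 + 2 * δ)) * ((∑' n, energy lam n (Φ n)) *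
          (∑' n, energy lam n (Γ n)) * ∑' n, energy lam n (H n))) := by
  obtain ⟨C, hC, hK⟩ := exists_tsum_tripleWeight_le hδ hδ'
  -- Covers both time estimates: 10 from the L² bound and 2 + 20 `bracketConst` from the L¹ bound.
  set c : ℝ≥0∞ := 10 + 20 * bracketConst with hc
  have hctop : c < ∞ := ENNReal.add_lt_top.2
    ⟨by norm_num, ENNReal.mul_lt_top (by norm_num) bracketConst_lt_top⟩
  refine ⟨2 * (C * c + 1), ENNReal.mul_lt_top (by norm_num)
    (ENNReal.add_lt_top.2 ⟨ENNReal.mul_lt_top hC hctop, by norm_num⟩), ?_⟩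
  intro lam s hl hs Φ Γ H hΦ hΓ hH
  have hl0 : 0 < lam := by linarith
  set L := ENNReal.ofReal (lam ^ (2 + 2 * δ)) with hL
  have hL1 : 1 ≤ L := ENNReal.one_le_ofReal.2 (Real.one_le_rpow hl (by linarith))
  set a : ℤ → ℝ≥0∞ := fun n => energy lam n (Φ n)
  set b : ℤ → ℝ≥0∞ := fun n => energy lam n (Γ n)
  set d : ℤ → ℝ≥0∞ := fun n => energy lam n (H n)
  set P := (∑' n, a n) * (∑' n, b n) * ∑' n, d n with hP
  have hKn : ∀ n, ∑' m, gainedMultiplier lam s n m ^ 2 ≤ C * L := fun n =>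
    (ENNReal.tsum_le_tsum fun m => sq_gainedMultiplier_le hl0 hs n m).trans (hK lam hl n)
  have hmul : ∀ n, ENNReal.ofReal (multiplier lam s n n (-n)) ≤ 1 := fun n =>
    ENNReal.ofReal_le_one.2 (multiplier_neg_le_one hs n)
  have final : ∀ X : ℤ → ℝ≥0∞, (∀ n, X n ≤ 2 * (C * L * ∑' m : ℤ × ℤ,
      c * (a m.1 * b m.2 * d (n - m.1 - m.2)) + a n * b n * d (-n))) →
      ∑' n, X n ≤ 2 * (C * c + 1) * L * P := by
    intro X hX
    refine (ENNReal.tsum_le_tsum hX).trans ?_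
    rw [ENNReal.tsum_mul_left, ENNReal.tsum_add, ENNReal.tsum_mul_left]
    simp only [ENNReal.tsum_mul_left]
    rw [tsum_tsum_mul_mul]
    calc _ ≤ 2 * (C * L * (c * P) + L * P) := by
          gcongr
          exact (tsum_mul_mul_neg_le a b d).trans (le_mul_of_one_le_left zero_le hL1)
      _ = _ := by ring
  have mT : ∀ i j k, Measurable (lconv3 (Φ i) (Γ j) (H k)) := fun i j k =>
    measurable_lconv3 (hΦ i) (hΓ j) (hH k)
  have mW : ∀ i j k, Measurable (weightedConv lam i j k (Φ i) (Γ j) (H k)) := fun i j k =>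
    measurable_weightedConv (hΦ i) (hΓ j) (hH k)
  constructor
  · refine final _ fun n => ?_
    have hpt : ∀ τ, (modWeight lam (-(1 / 2)) n τ * majorant lam s Φ Γ H n τ) ^ 2 ≤
        2 * ((∑' m : ℤ × ℤ, gainedMultiplier lam s n m * weightedConv lam m.1 m.2 (n - m.1 - m.2)
          (Φ m.1) (Γ m.2) (H (n - m.1 - m.2)) τ) ^ 2 + lconv3 (Φ n) (Γ n) (H (-n)) τ ^ 2) := by
      intro τ
      refine le_trans ?_ (add_sq_le _ _)
      rw [majorant, mul_add, ← ENNReal.tsum_mul_left]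
      refine pow_le_pow_left₀ zero_le (add_le_add (ENNReal.tsum_le_tsum fun m =>
        modWeight_neg_half_mul_le hl0 s n m (hΦ _) (hΓ _) (hH _) τ) ?_) 2
      exact (mul_le_of_le_one_left zero_le (modWeight_le_one lam (by norm_num) n τ)).trans
        (mul_le_of_le_one_left zero_le (hmul n))
    refine (lintegral_mono hpt).trans ?_
    rw [lintegral_const_mul' _ _ (by norm_num), lintegral_add_right _ ((mT _ _ _).pow_const 2)]
    gcongr
    · refine (lintegral_tsum_mul_sq_le _ (fun m : ℤ × ℤ => c * (a m.1 * b m.2 * d (n - m.1 - m.2)))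
        (fun m => mW _ _ _) fun m => ?_).trans (mul_le_mul_left (hKn n) _)
      refine (lintegral_weightedConv_sq_le (hΦ _) (hΓ _) (hH _)).trans ?_
      gcongr
      exact le_self_add
    · exact lintegral_lconv3_sq_le_energy (hΦ _) (hΓ _) (hH _)
  · refine final _ fun n => ?_
    have hpt : ∀ τ, modWeight lam (-1) n τ * majorant lam s Φ Γ H n τ ≤
        (∑' m : ℤ × ℤ, gainedMultiplier lam s n m * (lconv3 (Φ m.1) (Γ m.2) (H (n - m.1 - m.2)) τ +
          modWeight lam (-1) n τ * weightedConv lam m.1 m.2 (n - m.1 - m.2)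
          (Φ m.1) (Γ m.2) (H (n - m.1 - m.2)) τ)) + lconv3 (Φ n) (Γ n) (H (-n)) τ := by
      intro τ
      rw [majorant, mul_add, ← ENNReal.tsum_mul_left]
      refine add_le_add (ENNReal.tsum_le_tsum fun m =>
        modWeight_neg_one_mul_le hl0 s n m (hΦ _) (hΓ _) (hH _) τ) ?_
      exact (mul_le_of_le_one_left zero_le (modWeight_le_one lam (by norm_num) n τ)).trans
        (mul_le_of_le_one_left zero_le (hmul n))
    refine (pow_le_pow_left₀ zero_le (lintegral_mono hpt) 2).trans ?_
    rw [lintegral_add_right _ (mT _ _ _)]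
    refine (add_sq_le _ _).trans ?_
    gcongr
    · refine (sq_lintegral_tsum_mul_le _
        (fun m : ℤ × ℤ => c * (a m.1 * b m.2 * d (n - m.1 - m.2)))
        (fun m => (mT _ _ _).add ((measurable_modWeight lam (-1) n).mul (mW _ _ _)))
        fun m => ?_).trans (mul_le_mul_left (hKn n) _)
      refine (sq_lintegral_add_weightedConv_le (hΦ _) (hΓ _) (hH _) n).trans ?_
      gcongr
      rw [hc]
      gcongr
      norm_num
    · exact sq_lintegral_lconv3_le_energy (hΦ _) (hΓ _) (hH _)

/-- The weight `(⟨k₁⟩⟨k₂⟩⟨k₃⟩)^{-s}` is square summable over `k₁ + k₂ + k₃ = k`. -/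
theorem tsum_sq_inv_bracket_lt_top {lam s : ℝ} (hl : 1 ≤ lam) (hs : 1 / 2 ≤ s) (n : ℤ) :
    ∑' m : ℤ × ℤ, ENNReal.ofReal ((bracket (freq lam m.1) * bracket (freq lam m.2) *
      bracket (freq lam (n - m.1 - m.2))) ^ (-s)) ^ 2 < ∞ := by
  obtain ⟨C, hC, h⟩ := exists_tsum_tripleWeight_le (δ := 1 / 2) (by norm_num) le_rfl
  refine lt_of_le_of_lt ((ENNReal.tsum_le_tsum fun m => ?_).trans (h lam hl n))
    (ENNReal.mul_lt_top hC ENNReal.ofReal_lt_top)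
  have h1 := bracket_pos (freq lam m.1)
  have h2 := bracket_pos (freq lam m.2)
  have h3 := bracket_pos (freq lam (n - m.1 - m.2))
  rw [← ENNReal.ofReal_pow (by positivity)]
  exact ENNReal.ofReal_le_ofReal (sq_inv_bracket_rpow_le hs _ _ _ _)

end TrilinearEstimate

/-! ### From the norms to nonnegative functions -/

theorem rpow_half_sq (x : ℝ≥0∞) : (x ^ (1 / 2 : ℝ)) ^ 2 = x := by
  rw [← ENNReal.rpow_natCast, ← ENNReal.rpow_mul]; norm_num

/-- The function `⟨k⟩^s |ũ(k, τ)|`. -/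
def weightedTransform (lam s : ℝ) (a : ℤ → ℝ → ℂ) (n : ℤ) (τ : ℝ) : ℝ≥0∞ :=
  ENNReal.ofReal (bracket (freq lam n) ^ s) * ‖tFourier (a n) τ‖ₑ

theorem measurable_weightedTransform (lam s : ℝ) (a : ℤ → ℝ → ℂ) (n : ℤ) :
    Measurable (weightedTransform lam s a n) :=
  (measurable_tFourier (a n)).enorm.const_mul _

theorem ofReal_bracket_mul (lam s b : ℝ) (n : ℤ) (τ : ℝ) :
    ENNReal.ofReal (bracket (freq lam n) ^ s * bracket (modulation lam n τ) ^ b) =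
      modWeight lam b n τ * ENNReal.ofReal (bracket (freq lam n) ^ s) := by
  rw [ENNReal.ofReal_mul (Real.rpow_nonneg (bracket_pos _).le _), mul_comm]; rfl

theorem sq_XNorm {lam s b : ℝ} {a : ℤ → ℝ → ℂ} (ha : ∀ n, MemLp (a n) 2 volume) :
    XNorm lam s b a ^ 2 = ENNReal.ofReal (1 / lam) *
      ∑' n, ∫⁻ τ, (modWeight lam b n τ * weightedTransform lam s a n τ) ^ 2 := by
  rw [XNorm, if_pos ha, rpow_half_sq]
  simp only [ofReal_bracket_mul, weightedTransform, mul_assoc]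

theorem sq_L2L1Norm {lam s b : ℝ} {a : ℤ → ℝ → ℂ} (ha : ∀ n, MemLp (a n) 2 volume) :
    L2L1Norm lam s b a ^ 2 = ENNReal.ofReal (1 / lam) *
      ∑' n, (∫⁻ τ, modWeight lam b n τ * weightedTransform lam s a n τ) ^ 2 := by
  rw [L2L1Norm, if_pos ha, rpow_half_sq]
  simp only [ofReal_bracket_mul, weightedTransform, mul_assoc]

theorem memLp_of_XNorm_lt_top {lam s b : ℝ} {a : ℤ → ℝ → ℂ} (h : XNorm lam s b a < ∞) (n : ℤ) :
    MemLp (a n) 2 volume := by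
  by_contra hn
  rw [XNorm, if_neg fun H => hn (H n)] at h
  exact lt_irrefl _ h

theorem memLp_of_YNorm_lt_top {lam s : ℝ} {a : ℤ → ℝ → ℂ} (h : YNorm lam s a < ∞) (n : ℤ) :
    MemLp (a n) 2 volume :=
  memLp_of_XNorm_lt_top (lt_of_le_of_lt le_self_add h) n

/-- The left side is the squared Y norm without its cross term. -/
theorem tsum_energy_le {lam s : ℝ} {a : ℤ → ℝ → ℂ} (ha : ∀ n, MemLp (a n) 2 volume) :
    ENNReal.ofReal (1 / lam) * ∑' n, energy lam n (weightedTransform lam s a n) ≤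
      YNorm lam s a ^ 2 := by
  have e : ∀ n τ, modWeight lam 0 n τ = 1 := fun n τ => by simp [modWeight]
  have h1 := sq_L2L1Norm (lam := lam) (s := s) (b := 0) ha
  have h2 := sq_XNorm (lam := lam) (s := s) (b := 1 / 2) ha
  simp only [e, one_mul] at h1
  simp only [energy]
  rw [ENNReal.tsum_add, mul_add, ← h1, ← h2, YNorm]
  set x := XNorm lam s (1 / 2) a
  set y := L2L1Norm lam s 0 a
  calc y ^ 2 + x ^ 2 ≤ y ^ 2 + x ^ 2 + 2 * x * y := le_self_add
    _ = (x + y) ^ 2 := by ring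

theorem tsum_energy_lt_top {lam s : ℝ} (hl : 0 < lam) {a : ℤ → ℝ → ℂ} (h : YNorm lam s a < ∞) :
    ∑' n, energy lam n (weightedTransform lam s a n) < ∞ := by
  have h1 := (tsum_energy_le (memLp_of_YNorm_lt_top h)).trans_lt (ENNReal.pow_lt_top h (n := 2))
  refine (ENNReal.mul_lt_top_iff.1 h1).elim (fun h => h.2) fun h => ?_
  rcases h with h | h
  · exact absurd h (ENNReal.ofReal_pos.2 (by positivity)).ne'
  · rw [h]; exact ENNReal.zero_lt_top

theorem integrable_tFourier {lam s : ℝ} (hl : 0 < lam) {a : ℤ → ℝ → ℂ} (h : YNorm lam s a < ∞)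
    (n : ℤ) : Integrable (tFourier (a n)) := by
  refine ⟨(measurable_tFourier _).aestronglyMeasurable, ?_⟩
  have h1 := ((sq_lintegral_le_energy lam n (weightedTransform lam s a n)).trans
    (ENNReal.le_tsum n)).trans_lt (tsum_energy_lt_top hl h)
  have h2 := (ENNReal.pow_lt_top_iff.1 h1).resolve_right (by norm_num)
  simp only [weightedTransform] at h2
  rw [lintegral_const_mul _ (measurable_tFourier _).enorm] at h2
  refine (ENNReal.mul_lt_top_iff.1 h2).elim (fun h => h.2) fun h => ?_
  rcases h with h | h
  · exact absurd h (ENNReal.ofReal_pos.2 (Real.rpow_pos_of_pos (bracket_pos _) _)).ne'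
  · rw [HasFiniteIntegral, h]; exact ENNReal.zero_lt_top

/-- The weight `(⟨k₁⟩⟨k₂⟩⟨k₃⟩)^{-s}`. -/
def invBracket (lam s : ℝ) (n₁ n₂ n₃ : ℤ) : ℝ≥0∞ :=
  ENNReal.ofReal ((bracket (freq lam n₁) * bracket (freq lam n₂) * bracket (freq lam n₃)) ^ (-s))

theorem invBracket_mul (lam s : ℝ) (n₁ n₂ n₃ : ℤ) :
    invBracket lam s n₁ n₂ n₃ * (ENNReal.ofReal (bracket (freq lam n₁) ^ s) *
      ENNReal.ofReal (bracket (freq lam n₂) ^ s) * ENNReal.ofReal (bracket (freq lam n₃) ^ s))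
      = 1 := by
  have h1 := bracket_pos (freq lam n₁)
  have h2 := bracket_pos (freq lam n₂)
  have h3 := bracket_pos (freq lam n₃)
  rw [invBracket, ← ENNReal.ofReal_mul (by positivity), ← ENNReal.ofReal_mul (by positivity),
    ← ENNReal.ofReal_mul (by positivity), ← Real.mul_rpow h1.le h2.le,
    ← Real.mul_rpow (by positivity) h3.le, ← Real.rpow_add (by positivity)]
  simp

theorem lconv3_eq_invBracket_mul (lam s : ℝ) (a b c : ℤ → ℝ → ℂ) (n₁ n₂ n₃ : ℤ) (τ : ℝ) :
    lconv3 (‖tFourier (a n₁) ·‖ₑ) (‖tFourier (b n₂) ·‖ₑ) (‖tFourier (c n₃) ·‖ₑ) τ =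
      invBracket lam s n₁ n₂ n₃ * lconv3 (weightedTransform lam s a n₁)
        (weightedTransform lam s b n₂) (weightedTransform lam s c n₃) τ := by
  have h := lconv3_const_mul (measurable_tFourier (a n₁)).enorm (measurable_tFourier (b n₂)).enorm
    (measurable_tFourier (c n₃)).enorm (ENNReal.ofReal (bracket (freq lam n₁) ^ s))
    (ENNReal.ofReal (bracket (freq lam n₂) ^ s)) (ENNReal.ofReal (bracket (freq lam n₃) ^ s)) τ
  change lconv3 (weightedTransform lam s a n₁) (weightedTransform lam s b n₂)
    (weightedTransform lam s c n₃) τ = _ at h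
  rw [h, ← mul_assoc, invBracket_mul, one_mul]

theorem ofReal_mul_invBracket (lam s : ℝ) (n₁ n₂ n₃ : ℤ) :
    ENNReal.ofReal (bracket (freq lam (n₁ + n₂ + n₃)) ^ s) *
      ENNReal.ofReal |freq lam (n₁ + n₂ + n₃)| * invBracket lam s n₁ n₂ n₃ =
      ENNReal.ofReal (multiplier lam s n₁ n₂ n₃) := by
  have h1 := bracket_pos (freq lam n₁)
  have h2 := bracket_pos (freq lam n₂)
  have h3 := bracket_pos (freq lam n₃)
  have h := bracket_pos (freq lam (n₁ + n₂ + n₃))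
  rw [invBracket, ← ENNReal.ofReal_mul (by positivity), ← ENNReal.ofReal_mul (by positivity),
    multiplier, Real.div_rpow h.le (by positivity), Real.rpow_neg (by positivity)]
  congr 1
  ring

theorem tsum_mul_mul_lt_top {A B D : ℤ → ℝ≥0∞} (hA : ∑' n, A n < ∞) (hB : ∑' n, B n < ∞)
    (hD : ∑' n, D n < ∞) (n : ℤ) :
    ∑' m : ℤ × ℤ, A m.1 * B m.2 * D (n - m.1 - m.2) < ∞ := by
  refine (ENNReal.le_tsum (f := fun n => ∑' m : ℤ × ℤ, A m.1 * B m.2 * D (n - m.1 - m.2))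
    n).trans_lt ?_
  rw [tsum_tsum_mul_mul]
  exact ENNReal.mul_lt_top (ENNReal.mul_lt_top hA hB) hD

theorem tsum_sq_invBracket_lt_top {lam s : ℝ} (hl : 1 ≤ lam) (hs : 1 / 2 ≤ s) (n : ℤ) :
    ∑' m : ℤ × ℤ, invBracket lam s m.1 m.2 (n - m.1 - m.2) ^ 2 < ∞ :=
  tsum_sq_inv_bracket_lt_top hl hs n

/-- Summability of the trilinear expression for coefficients in weighted `ℓ²`. -/
theorem summable_nonresTerm {lam s : ℝ} (hl : 1 ≤ lam) (hs : 1 / 2 ≤ s) {a b c : ℤ → ℝ → ℂ}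
    {t : ℝ} (ha : ∑' n, (ENNReal.ofReal (bracket (freq lam n) ^ s) * ‖a n t‖ₑ) ^ 2 < ∞)
    (hb : ∑' n, (ENNReal.ofReal (bracket (freq lam n) ^ s) * ‖b n t‖ₑ) ^ 2 < ∞)
    (hc : ∑' n, (ENNReal.ofReal (bracket (freq lam n) ^ s) * ‖c n t‖ₑ) ^ 2 < ∞) (n : ℤ) :
    Summable (nonresTerm a b c n t) := by
  refine Summable.of_norm (tsum_enorm_ne_top_iff_summable_norm.1 (ne_of_lt ?_))
  set w : ℤ → ℝ≥0∞ := fun n => ENNReal.ofReal (bracket (freq lam n) ^ s) with hw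
  have hle : ∀ m : ℤ × ℤ, ‖nonresTerm a b c n t m‖ₑ ≤ invBracket lam s m.1 m.2 (n - m.1 - m.2) *
      ((w m.1 * ‖a m.1 t‖ₑ) * (w m.2 * ‖b m.2 t‖ₑ) *
        (w (n - m.1 - m.2) * ‖c (n - m.1 - m.2) t‖ₑ)) := fun m => by
    unfold nonresTerm
    split_ifs
    · rw [enorm_mul, enorm_mul]
      refine le_of_eq ?_
      calc _ = 1 * (‖a m.1 t‖ₑ * ‖b m.2 t‖ₑ * ‖c (n - m.1 - m.2) t‖ₑ) := (one_mul _).symm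
        _ = _ := by rw [← invBracket_mul lam s m.1 m.2 (n - m.1 - m.2)]; ring
    · simp
  refine (ENNReal.tsum_le_tsum hle).trans_lt ?_
  -- Cauchy–Schwarz between the square summable weight and the product of the three weighted
  -- coefficients.
  refine (ENNReal.pow_lt_top_iff.1 ((sq_tsum_mul_le _ _).trans_lt (ENNReal.mul_lt_top
    (tsum_sq_invBracket_lt_top hl hs n) ?_))).resolve_right (by norm_num)
  simp only [mul_pow] at ha hb hc ⊢
  exact tsum_mul_mul_lt_top ha hb hc n

/-- Plancherel in t and Tonelli. Only the X part is used, so absolute convergence of the sum holds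
even when the Y norm is infinite. -/
theorem ae_tsum_sq_lt_top {lam s : ℝ} (hl : 0 < lam) {a : ℤ → ℝ → ℂ}
    (h : XNorm lam s (1 / 2) a < ∞) :
    ∀ᵐ t, ∑' n, (ENNReal.ofReal (bracket (freq lam n) ^ s) * ‖a n t‖ₑ) ^ 2 < ∞ := by
  have ha := memLp_of_XNorm_lt_top h
  have hm : ∀ n, AEMeasurable
      (fun t => (ENNReal.ofReal (bracket (freq lam n) ^ s) * ‖a n t‖ₑ) ^ 2) volume := fun n =>
    ((ha n).aestronglyMeasurable.enorm.const_mul _).pow_const 2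
  refine ae_lt_top' (AEMeasurable.tsum hm) (ne_of_lt ?_)
  rw [lintegral_tsum hm]
  have h1 := ENNReal.pow_lt_top h (n := 2)
  rw [sq_XNorm ha] at h1
  have h2 : ∑' n, ∫⁻ τ, (modWeight lam (1 / 2) n τ * weightedTransform lam s a n τ) ^ 2 < ∞ := by
    refine (ENNReal.mul_lt_top_iff.1 h1).elim (fun h => h.2) fun h => ?_
    rcases h with h | h
    · exact absurd h (ENNReal.ofReal_pos.2 (by positivity)).ne'
    · rw [h]; exact ENNReal.zero_lt_top
  refine (ENNReal.tsum_le_tsum fun n => ?_).trans_lt h2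
  calc ∫⁻ t, (ENNReal.ofReal (bracket (freq lam n) ^ s) * ‖a n t‖ₑ) ^ 2
      = ENNReal.ofReal (bracket (freq lam n) ^ s) ^ 2 * ∫⁻ t, ‖a n t‖ₑ ^ 2 := by
        simp only [mul_pow]
        rw [lintegral_const_mul'' _ ((ha n).aestronglyMeasurable.enorm.pow_const 2)]
    _ = ∫⁻ τ, weightedTransform lam s a n τ ^ 2 := by
        rw [← lintegral_tFourier_sq (ha n),
          ← lintegral_const_mul _ ((measurable_tFourier _).enorm.pow_const 2)]
        simp only [weightedTransform, mul_pow]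
    _ ≤ _ := by
        refine lintegral_mono fun τ => ?_
        gcongr
        exact le_mul_of_one_le_left zero_le (one_le_modWeight lam (by norm_num) n τ)

/-! ### The Fourier transform of the trilinear expression -/

/-- The trilinear expression `Jhat` for families of Fourier coefficients. -/
def trilinear (lam : ℝ) (a b c : ℤ → ℝ → ℂ) (n : ℤ) (t : ℝ) : ℂ :=
  Complex.I * (freq lam n : ℂ) / 3 * ((1 / (lam : ℂ) ^ 2) * ∑' m : ℤ × ℤ, nonresTerm a b c n t m)
    - Complex.I * (freq lam n : ℂ) * ((1 / (lam : ℂ) ^ 2) * (a n t * b n t * c (-n) t))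

/-- The Fourier transform of `nonresTerm`. -/
def nonresConv (f g h : ℤ → ℝ → ℂ) (n : ℤ) (m : ℤ × ℤ) (τ : ℝ) : ℂ :=
  if (m.1 + m.2) * (m.2 + (n - m.1 - m.2)) * ((n - m.1 - m.2) + m.1) ≠ 0 then
    conv3 (f m.1) (g m.2) (h (n - m.1 - m.2)) τ
  else 0

section NonresConv

variable {f g h : ℤ → ℝ → ℂ}

theorem integrable_nonresConv (hf : ∀ n, Integrable (f n)) (hg : ∀ n, Integrable (g n))
    (hh : ∀ n, Integrable (h n)) (n : ℤ) (m : ℤ × ℤ) : Integrable (nonresConv f g h n m) := by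
  unfold nonresConv
  split_ifs
  · exact integrable_conv3 (hf _) (hg _) (hh _)
  · exact integrable_zero _ _ _

theorem fourierInv_nonresConv (hf : ∀ n, Integrable (f n)) (hg : ∀ n, Integrable (g n))
    (hh : ∀ n, Integrable (h n)) (n : ℤ) (m : ℤ × ℤ) (t : ℝ) :
    𝓕⁻ (nonresConv f g h n m) t =
      nonresTerm (fun n => 𝓕⁻ (f n)) (fun n => 𝓕⁻ (g n)) (fun n => 𝓕⁻ (h n)) n t m := by
  unfold nonresConv nonresTerm
  split_ifs
  · exact fourierInv_conv3 (hf _) (hg _) (hh _) t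
  · simp [Real.fourierInv_eq]

theorem fourierInv_tsum {ι : Type*} [Countable ι] {F : ι → ℝ → ℂ} (hF : ∀ i, Integrable (F i))
    (hs : ∑' i, ∫⁻ τ, ‖F i τ‖ₑ ≠ ∞) (t : ℝ) :
    𝓕⁻ (fun τ => ∑' i, F i τ) t = ∑' i, 𝓕⁻ (F i) t := by
  simp only [Real.fourierInv_eq]
  have e : ∀ v : ℝ, Real.fourierChar (inner ℝ v t) • ∑' i, F i v =
      ∑' i, Real.fourierChar (inner ℝ v t) • F i v := fun v => by
    simp only [Circle.smul_def, smul_eq_mul, tsum_mul_left]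
  simp only [e]
  refine integral_tsum (fun i => ?_) ?_
  · have hc : Continuous fun v : ℝ => Real.fourierChar (inner ℝ v t) :=
      Real.continuous_fourierChar.comp (by fun_prop)
    exact hc.aestronglyMeasurable.smul (hF i).aestronglyMeasurable
  · have e' : ∀ i v, ‖Real.fourierChar (inner ℝ v t) • F i v‖ₑ = ‖F i v‖ₑ := fun i v => by
      rw [← ofReal_norm, Circle.norm_smul, ofReal_norm]
    simpa only [e'] using hs

end NonresConv

/-- Finite Y norms make all input transforms integrable, so the transform of the output is a
convergent series of triple convolutions, which the triangle inequality compares with the majorant.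
-/
theorem trilinear_estimate_aux {lam s : ℝ} (hl : 1 ≤ lam) (hs : 1 / 2 ≤ s) {a b c : ℤ → ℝ → ℂ}
    (ha : YNorm lam s a < ∞) (hb : YNorm lam s b < ∞) (hc : YNorm lam s c < ∞) (n : ℤ) :
    MemLp (trilinear lam a b c n) 2 volume ∧
      ∀ᵐ τ, weightedTransform lam s (trilinear lam a b c) n τ ≤ ENNReal.ofReal (1 / lam) ^ 2 *
        majorant lam s (weightedTransform lam s a) (weightedTransform lam s b)
          (weightedTransform lam s c) n τ := by
  have hl0 : 0 < lam := by linarith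
  set f : ℤ → ℝ → ℂ := fun n => tFourier (a n) with hf
  set g : ℤ → ℝ → ℂ := fun n => tFourier (b n) with hg
  set h : ℤ → ℝ → ℂ := fun n => tFourier (c n) with hh
  set Φ := weightedTransform lam s a
  set Γ := weightedTransform lam s b
  set H := weightedTransform lam s c
  have fi : ∀ n, Integrable (f n) := integrable_tFourier hl0 ha
  have gi : ∀ n, Integrable (g n) := integrable_tFourier hl0 hb
  have hi : ∀ n, Integrable (h n) := integrable_tFourier hl0 hc
  have mΦ : ∀ n, Measurable (Φ n) := measurable_weightedTransform lam s a
  have mΓ : ∀ n, Measurable (Γ n) := measurable_weightedTransform lam s b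
  have mH : ∀ n, Measurable (H n) := measurable_weightedTransform lam s c
  set V : ℤ × ℤ → ℝ≥0∞ := fun m => invBracket lam s m.1 m.2 (n - m.1 - m.2)
  set T : ℤ × ℤ → ℝ → ℝ≥0∞ := fun m => lconv3 (Φ m.1) (Γ m.2) (H (n - m.1 - m.2))
  have mT : ∀ m, Measurable (T m) := fun m => measurable_lconv3 (mΦ _) (mΓ _) (mH _)
  have hV : ∑' m, V m ^ 2 < ∞ := tsum_sq_invBracket_lt_top hl hs n
  have hE := tsum_mul_mul_lt_top (tsum_energy_lt_top hl0 ha) (tsum_energy_lt_top hl0 hb)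
    (tsum_energy_lt_top hl0 hc) n
  have hle : ∀ m τ, ‖nonresConv f g h n m τ‖ₑ ≤ V m * T m τ := fun m τ => by
    unfold nonresConv
    split_ifs
    · refine (enorm_conv3_le _ _ _ _).trans (le_of_eq ?_)
      exact lconv3_eq_invBracket_mul lam s a b c _ _ _ τ
    · simp
  -- Only finiteness for fixed n matters here, so the square summable weight `V` replaces the
  -- resonance gain.
  have hL1 : ∫⁻ τ, ∑' m, V m * T m τ < ∞ := by
    have := sq_lintegral_tsum_mul_le V _ mT fun m =>
      sq_lintegral_lconv3_le_energy (lam := lam) (n₁ := m.1) (n₂ := m.2) (n₃ := n - m.1 - m.2)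
        (mΦ m.1) (mΓ m.2) (mH (n - m.1 - m.2))
    exact (ENNReal.pow_lt_top_iff.1 (this.trans_lt (ENNReal.mul_lt_top hV hE))).resolve_right
      (by norm_num)
  have hL2 : ∫⁻ τ, (∑' m, V m * T m τ) ^ 2 < ∞ := by
    have := lintegral_tsum_mul_sq_le V _ mT fun m =>
      lintegral_lconv3_sq_le_energy (lam := lam) (n₁ := m.1) (n₂ := m.2) (n₃ := n - m.1 - m.2)
        (mΦ m.1) (mΓ m.2) (mH (n - m.1 - m.2))
    exact this.trans_lt (ENNReal.mul_lt_top hV hE)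
  have hFi := integrable_nonresConv fi gi hi n
  set G : ℝ → ℂ := fun τ => ∑' m, nonresConv f g h n m τ with hG
  have hGle : ∀ τ, ‖G τ‖ₑ ≤ ∑' m, V m * T m τ := fun τ =>
    enorm_tsum_le_tsum_enorm.trans (ENNReal.tsum_le_tsum fun m => hle m τ)
  have hGm : AEStronglyMeasurable G volume :=
    (AEMeasurable.tsum fun m => (hFi m).aestronglyMeasurable.aemeasurable).aestronglyMeasurable
  have hGi : Integrable G := ⟨hGm, (lintegral_mono hGle).trans_lt hL1⟩
  have hG2 : MemLp G 2 volume := memLp_two_of_lintegral_lt_top hGm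
    ((lintegral_mono fun τ => pow_le_pow_left₀ zero_le (hGle τ) 2).trans_lt hL2)
  set R : ℝ → ℂ := conv3 (f n) (g n) (h (-n)) with hR
  have hRi : Integrable R := integrable_conv3 (fi _) (gi _) (hi _)
  have hRle : ∀ τ, ‖R τ‖ₑ ≤ invBracket lam s n n (-n) * lconv3 (Φ n) (Γ n) (H (-n)) τ := fun τ =>
    (enorm_conv3_le _ _ _ _).trans (le_of_eq (lconv3_eq_invBracket_mul lam s a b c _ _ _ τ))
  have hR2 : MemLp R 2 volume := by
    refine memLp_two_of_lintegral_lt_top hRi.aestronglyMeasurable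
      ((lintegral_mono fun τ => pow_le_pow_left₀ zero_le (hRle τ) 2).trans_lt ?_)
    simp only [mul_pow]
    rw [lintegral_const_mul _ ((measurable_lconv3 (mΦ _) (mΓ _) (mH _)).pow_const 2)]
    refine ENNReal.mul_lt_top (ENNReal.pow_lt_top ENNReal.ofReal_lt_top)
      ((lintegral_lconv3_sq_le_energy (lam := lam) (n₁ := n) (n₂ := n) (n₃ := -n) (mΦ n) (mΓ n)
        (mH (-n))).trans_lt (ENNReal.mul_lt_top (ENNReal.mul_lt_top ?_ ?_) ?_))
    · exact (ENNReal.le_tsum n).trans_lt (tsum_energy_lt_top hl0 ha)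
    · exact (ENNReal.le_tsum n).trans_lt (tsum_energy_lt_top hl0 hb)
    · exact (ENNReal.le_tsum (-n)).trans_lt (tsum_energy_lt_top hl0 hc)
  set c₁ : ℂ := Complex.I * (freq lam n : ℂ) / 3 * (1 / (lam : ℂ) ^ 2) with hc₁
  set c₂ : ℂ := Complex.I * (freq lam n : ℂ) * (1 / (lam : ℂ) ^ 2) with hc₂
  set J : ℝ → ℂ := fun τ => c₁ * G τ - c₂ * R τ with hJ
  have hJi : Integrable J := (hGi.const_mul c₁).sub (hRi.const_mul c₂)
  have hJ2 : MemLp J 2 volume := (hG2.const_mul c₁).sub (hR2.const_mul c₂)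
  have hfin : ∑' m, ∫⁻ τ, ‖nonresConv f g h n m τ‖ₑ ≠ ∞ := by
    rw [← lintegral_tsum fun m => (hFi m).aestronglyMeasurable.enorm]
    exact ((lintegral_mono fun τ => ENNReal.tsum_le_tsum fun m => hle m τ).trans_lt hL1).ne
  have hJinv : ∀ t, 𝓕⁻ J t = trilinear lam (fun n => 𝓕⁻ (f n)) (fun n => 𝓕⁻ (g n))
      (fun n => 𝓕⁻ (h n)) n t := by
    intro t
    have e1 : 𝓕⁻ J t = c₁ * 𝓕⁻ G t - c₂ * 𝓕⁻ R t := by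
      have hch : ∀ F : ℝ → ℂ, Integrable F →
          Integrable fun v : ℝ => Real.fourierChar (inner ℝ v t) • F v := fun F hF => by
        simpa using (Real.fourierIntegral_convergent_iff (-t)).2 hF
      simp only [Real.fourierInv_eq]
      rw [← integral_const_mul, ← integral_const_mul,
        ← integral_sub ((hch G hGi).const_mul _) ((hch R hRi).const_mul _)]
      congr 1; ext v
      simp only [hJ, Circle.smul_def, smul_eq_mul]
      ring
    rw [e1, hG, fourierInv_tsum hFi hfin, hR, fourierInv_conv3 (fi _) (gi _) (hi _), trilinear]
    simp only [fourierInv_nonresConv fi gi hi]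
    ring
  -- Inversion holds off a null set for each frequency; countability gives a single null set for all
  -- of them.
  have hae : trilinear lam a b c n =ᵐ[volume] 𝓕⁻ J := by
    have A := ae_all_iff.2 fun n => eq_fourierInv_tFourier (memLp_of_YNorm_lt_top ha n) (fi n)
    have B := ae_all_iff.2 fun n => eq_fourierInv_tFourier (memLp_of_YNorm_lt_top hb n) (gi n)
    have C := ae_all_iff.2 fun n => eq_fourierInv_tFourier (memLp_of_YNorm_lt_top hc n) (hi n)
    filter_upwards [A, B, C] with t h1 h2 h3
    rw [hJinv]
    simp only [trilinear, nonresTerm, h1, h2, h3, hf, hg, hh]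
  obtain ⟨hmem, htf⟩ := tFourier_ae_eq_of_ae_eq_fourierInv hJi hJ2 hae
  refine ⟨hmem, ?_⟩
  filter_upwards [htf] with τ hτ
  set q := ENNReal.ofReal (1 / lam)
  set κ := ENNReal.ofReal |freq lam n|
  have hc₂' : ‖c₂‖ₑ = q ^ 2 * κ := by
    rw [hc₂, enorm_mul, enorm_mul, mul_comm]
    congr 1
    · rw [← ofReal_norm, norm_div, norm_pow, Complex.norm_real, Real.norm_of_nonneg hl0.le,
        ← ENNReal.ofReal_pow (by positivity)]
      simp
    · rw [← ofReal_norm, ← ofReal_norm, Complex.norm_I, Complex.norm_real]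
      simp [κ]
  have hc₁' : ‖c₁‖ₑ ≤ q ^ 2 * κ := by
    rw [← hc₂', ← ofReal_norm, ← ofReal_norm]
    refine ENNReal.ofReal_le_ofReal ?_
    have : c₁ = c₂ / 3 := by rw [hc₁, hc₂]; ring
    rw [this, norm_div]
    refine div_le_self (norm_nonneg _) ?_
    simp
  set W := ENNReal.ofReal (bracket (freq lam n) ^ s) with hW
  have hJle : ‖J τ‖ₑ ≤ q ^ 2 * κ * ∑' m, ‖nonresConv f g h n m τ‖ₑ + q ^ 2 * κ * ‖R τ‖ₑ := by
    refine enorm_sub_le.trans (add_le_add ?_ ?_)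
    · rw [enorm_mul]
      exact mul_le_mul' hc₁' enorm_tsum_le_tsum_enorm
    · rw [enorm_mul, hc₂']
  have e1 : ∀ m : ℤ × ℤ, W * κ * ‖nonresConv f g h n m τ‖ₑ ≤ nonresMultiplier lam s n m *
      lconv3 (Φ m.1) (Γ m.2) (H (n - m.1 - m.2)) τ := fun m => by
    unfold nonresMultiplier nonresConv
    split_ifs
    · refine (mul_le_mul_right ((enorm_conv3_le _ _ _ _).trans (le_of_eq
        (lconv3_eq_invBracket_mul lam s a b c _ _ _ τ))) _).trans (le_of_eq ?_)
      have := ofReal_mul_invBracket lam s m.1 m.2 (n - m.1 - m.2)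
      rw [sum_eq] at this
      rw [← this, mul_assoc, mul_assoc, mul_assoc]
    · simp
  have e2 : W * κ * ‖R τ‖ₑ ≤ ENNReal.ofReal (multiplier lam s n n (-n)) *
      lconv3 (Φ n) (Γ n) (H (-n)) τ := by
    refine (mul_le_mul_right (hRle τ) _).trans (le_of_eq ?_)
    have := ofReal_mul_invBracket lam s n n (-n)
    rw [show n + n + -n = n by ring] at this
    rw [← this, mul_assoc, mul_assoc, mul_assoc]
  calc weightedTransform lam s (trilinear lam a b c) n τ = W * ‖J τ‖ₑ := by
        rw [weightedTransform, hτ]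
    _ ≤ W * (q ^ 2 * κ * ∑' m, ‖nonresConv f g h n m τ‖ₑ + q ^ 2 * κ * ‖R τ‖ₑ) := by gcongr
    _ = q ^ 2 * (∑' m, W * κ * ‖nonresConv f g h n m τ‖ₑ + W * κ * ‖R τ‖ₑ) := by
        rw [ENNReal.tsum_mul_left]; ring
    _ ≤ _ := by
        exact mul_le_mul_right (add_le_add (ENNReal.tsum_le_tsum e1) e2) _

/-! ### The trilinear estimate -/

theorem exists_ZNorm_trilinear_le {δ : ℝ} (hδ : 0 < δ) (hδ' : δ ≤ 1 / 2) :
    ∃ C : ℝ, 0 < C ∧ ∀ lam s : ℝ, 1 ≤ lam → 1 / 2 ≤ s → ∀ a b c : ℤ → ℝ → ℂ,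
      YNorm lam s a < ∞ → YNorm lam s b < ∞ → YNorm lam s c < ∞ →
      ZNorm lam s (trilinear lam a b c) ≤ ENNReal.ofReal (C * lam ^ δ) * YNorm lam s a *
        YNorm lam s b * YNorm lam s c := by
  obtain ⟨C, hC, hmain⟩ := exists_lintegral_majorant_le hδ hδ'
  set D := (C ^ (1 / 2 : ℝ)).toReal with hD
  have hCD : C = ENNReal.ofReal D ^ 2 := by
    rw [hD, ENNReal.ofReal_toReal (ENNReal.rpow_lt_top_of_nonneg (by norm_num) hC.ne).ne,
      rpow_half_sq]
  have hD0 : 0 ≤ D := ENNReal.toReal_nonneg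
  -- The 2 counts the two parts of the Z norm; the 1 ensures positivity when D = 0.
  refine ⟨2 * D + 1, by positivity, ?_⟩
  intro lam s hl hs a b c ha hb hc
  have hl0 : 0 < lam := by linarith
  have haux := trilinear_estimate_aux hl hs ha hb hc
  have hmem : ∀ n, MemLp (trilinear lam a b c n) 2 volume := fun n => (haux n).1
  obtain ⟨hX, hL⟩ := hmain lam s hl hs (weightedTransform lam s a) (weightedTransform lam s b)
    (weightedTransform lam s c) (measurable_weightedTransform lam s a)
    (measurable_weightedTransform lam s b) (measurable_weightedTransform lam s c)
  have Ea := tsum_energy_le (lam := lam) (s := s) (memLp_of_YNorm_lt_top ha)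
  have Eb := tsum_energy_le (lam := lam) (s := s) (memLp_of_YNorm_lt_top hb)
  have Ec := tsum_energy_le (lam := lam) (s := s) (memLp_of_YNorm_lt_top hc)
  set q := ENNReal.ofReal (1 / lam) with hq
  set M := majorant lam s (weightedTransform lam s a) (weightedTransform lam s b)
    (weightedTransform lam s c)
  set A := ∑' n, energy lam n (weightedTransform lam s a n)
  set B := ∑' n, energy lam n (weightedTransform lam s b n)
  set E := ∑' n, energy lam n (weightedTransform lam s c n)
  set Y := ENNReal.ofReal (D * lam ^ δ) * YNorm lam s a * YNorm lam s b * YNorm lam s c with hY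
  have hpow : q ^ 2 * ENNReal.ofReal (lam ^ (2 + 2 * δ)) = ENNReal.ofReal (lam ^ δ) ^ 2 := by
    rw [hq, ← ENNReal.ofReal_pow (by positivity), ← ENNReal.ofReal_mul (by positivity),
      ← ENNReal.ofReal_pow (by positivity), Real.rpow_add hl0, Real.rpow_two,
      mul_comm 2 δ, Real.rpow_mul hl0.le, Real.rpow_two]
    congr 1
    field_simp
  have key : ∀ X : ℝ≥0∞, X ≤ C * ENNReal.ofReal (lam ^ (2 + 2 * δ)) * (A * B * E) →
      q * ((q ^ 2) ^ 2 * X) ≤ Y ^ 2 := by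
    intro X hX
    calc q * ((q ^ 2) ^ 2 * X)
        ≤ q * ((q ^ 2) ^ 2 * (C * ENNReal.ofReal (lam ^ (2 + 2 * δ)) * (A * B * E))) := by gcongr
      -- Of the five factors 1/λ, one from the output measure and four from the squared prefactor,
      -- three normalize the input norms and two reduce λ^{2+2δ} to λ^{2δ}.
      _ = C * (q ^ 2 * ENNReal.ofReal (lam ^ (2 + 2 * δ))) * ((q * A) * (q * B) * (q * E)) := by
          ring
      _ ≤ C * (q ^ 2 * ENNReal.ofReal (lam ^ (2 + 2 * δ))) *
          (YNorm lam s a ^ 2 * YNorm lam s b ^ 2 * YNorm lam s c ^ 2) := by gcongr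
      _ = Y ^ 2 := by
          rw [hpow, hCD, hY, ENNReal.ofReal_mul hD0]; ring
  have hXY : XNorm lam s (-(1 / 2)) (trilinear lam a b c) ≤ Y := by
    rw [← ENNReal.pow_le_pow_left_iff two_ne_zero, sq_XNorm hmem]
    refine le_trans ?_ (key _ hX)
    rw [← ENNReal.tsum_mul_left (a := (q ^ 2) ^ 2)]
    gcongr with n
    rw [← lintegral_const_mul' _ _ (by simp [hq])]
    refine lintegral_mono_ae ?_
    filter_upwards [(haux n).2] with τ hτ
    rw [← mul_pow, mul_left_comm]
    exact pow_le_pow_left₀ zero_le (mul_le_mul_right hτ _) 2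
  have hLY : L2L1Norm lam s (-1) (trilinear lam a b c) ≤ Y := by
    rw [← ENNReal.pow_le_pow_left_iff two_ne_zero, sq_L2L1Norm hmem]
    refine le_trans ?_ (key _ hL)
    rw [← ENNReal.tsum_mul_left (a := (q ^ 2) ^ 2)]
    gcongr with n
    rw [← mul_pow, ← lintegral_const_mul' _ _ (by simp [hq])]
    gcongr 1
    refine lintegral_mono_ae ?_
    filter_upwards [(haux n).2] with τ hτ
    rw [mul_left_comm]
    exact mul_le_mul_right hτ _
  calc ZNorm lam s (trilinear lam a b c) ≤ Y + Y := add_le_add hXY hLY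
    _ = ENNReal.ofReal (2 * D * lam ^ δ) * YNorm lam s a * YNorm lam s b * YNorm lam s c := by
        rw [hY, mul_assoc 2 D, ENNReal.ofReal_mul (p := 2) (by norm_num)]
        simp only [ENNReal.ofReal_ofNat]; ring
    _ ≤ _ := by
        gcongr
        linarith

theorem ae_eq_zero_of_YNorm_eq_zero {lam s : ℝ} (hl : 0 < lam) {a : ℤ → ℝ → ℂ}
    (h : YNorm lam s a = 0) : ∀ᵐ t, ∀ n, a n t = 0 := by
  have hlt : YNorm lam s a < ∞ := by rw [h]; exact ENNReal.zero_lt_top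
  have hmem := memLp_of_YNorm_lt_top hlt
  refine ae_all_iff.2 fun n => ?_
  have h1 := tsum_energy_le (lam := lam) (s := s) hmem
  rw [h, zero_pow two_ne_zero, nonpos_iff_eq_zero, mul_eq_zero] at h1
  have h2 := ENNReal.tsum_eq_zero.1
    (h1.resolve_left (ENNReal.ofReal_pos.2 (by positivity)).ne') n
  have h3 := lintegral_sq_le_energy lam n (weightedTransform lam s a n)
  rw [h2, nonpos_iff_eq_zero] at h3
  simp only [weightedTransform, mul_pow] at h3
  rw [lintegral_const_mul _ ((measurable_tFourier _).enorm.pow_const 2), mul_eq_zero] at h3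
  have h4 := h3.resolve_left
    (pow_ne_zero 2 (ENNReal.ofReal_pos.2 (Real.rpow_pos_of_pos (bracket_pos _) _)).ne')
  rw [lintegral_tFourier_sq (hmem n), lintegral_eq_zero_iff'
    ((hmem n).aestronglyMeasurable.enorm.pow_const 2)] at h4
  filter_upwards [h4] with t ht
  simpa using ht

theorem ZNorm_eq_zero {lam s : ℝ} {a : ℤ → ℝ → ℂ} (h : ∀ n, a n =ᵐ[volume] 0) :
    ZNorm lam s a = 0 := by
  have h1 := fun n => tFourier_ae_eq_zero (h n)
  have hmem : ∀ n, MemLp (a n) 2 volume := fun n => (h1 n).1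
  have hw : ∀ n, weightedTransform lam s a n =ᵐ[volume] 0 := fun n => by
    filter_upwards [(h1 n).2] with τ hτ
    simp [weightedTransform, hτ]
  have hX : XNorm lam s (-(1 / 2)) a ^ 2 = 0 := by
    rw [sq_XNorm hmem, mul_eq_zero]
    refine Or.inr (ENNReal.tsum_eq_zero.2 fun n => ?_)
    refine (lintegral_congr_ae ?_).trans lintegral_zero
    filter_upwards [hw n] with τ hτ
    simp [hτ]
  have hL : L2L1Norm lam s (-1) a ^ 2 = 0 := by
    rw [sq_L2L1Norm hmem, mul_eq_zero]
    refine Or.inr (ENNReal.tsum_eq_zero.2 fun n => ?_)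
    rw [sq_eq_zero_iff]
    refine (lintegral_congr_ae ?_).trans lintegral_zero
    filter_upwards [hw n] with τ hτ
    simp [hτ]
  rw [ZNorm, sq_eq_zero_iff.1 hX, sq_eq_zero_iff.1 hL, add_zero]

/-- Handles the convention 0·∞ = 0: one vanishing input must force a vanishing output even if
another norm is infinite. -/
theorem ZNorm_trilinear_eq_zero {lam s : ℝ} (hl : 0 < lam) {a b c : ℤ → ℝ → ℂ}
    (h : YNorm lam s a = 0 ∨ YNorm lam s b = 0 ∨ YNorm lam s c = 0) :
    ZNorm lam s (trilinear lam a b c) = 0 := by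
  refine ZNorm_eq_zero fun n => ?_
  rcases h with h | h | h <;>
  · filter_upwards [ae_eq_zero_of_YNorm_eq_zero hl h] with t ht
    simp [trilinear, nonresTerm, ht]

end MKdV

end

/-! ### Reduction to finite, nonzero Y norms. -/

theorem proposition3p2 (s : ℝ) (hs : 1 / 2 ≤ s) (ε : ℝ) (hε : 0 < ε) :
    ∃ C : ℝ, 0 < C ∧ ∀ (lam : ℝ) [Fact (0 < lam)], 1 ≤ lam →
      ∀ u v w : AddCircle lam × ℝ → ℂ,
        MKdV.MemX s (1 / 2) u → MKdV.MemX s (1 / 2) v → MKdV.MemX s (1 / 2) w →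
          (∀ᵐ t : ℝ, ∀ n : ℤ, Summable
            (MKdV.nonresTerm (MKdV.xFourier u) (MKdV.xFourier v) (MKdV.xFourier w) n t)) ∧
          MKdV.ZNorm lam s (MKdV.Jhat u v w) ≤
            ENNReal.ofReal (C * lam ^ ε) * MKdV.YNorm lam s (MKdV.xFourier u) *
              MKdV.YNorm lam s (MKdV.xFourier v) * MKdV.YNorm lam s (MKdV.xFourier w) := by
  -- The interpolation needs δ ≤ 1/2; since λ ≥ 1, a smaller exponent only strengthens the bound.
  obtain ⟨C, hC, h⟩ := MKdV.exists_ZNorm_trilinear_le (δ := min ε (1 / 2))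
    (lt_min hε (by norm_num)) (min_le_right _ _)
  refine ⟨C, hC, ?_⟩
  intro lam hlam hl u v w hu hv hw
  have hl0 : 0 < lam := hlam.out
  constructor
  · filter_upwards [MKdV.ae_tsum_sq_lt_top hl0 hu.2, MKdV.ae_tsum_sq_lt_top hl0 hv.2,
      MKdV.ae_tsum_sq_lt_top hl0 hw.2] with t h1 h2 h3
    exact MKdV.summable_nonresTerm hl hs h1 h2 h3
  · change MKdV.ZNorm lam s (MKdV.trilinear lam (MKdV.xFourier u) (MKdV.xFourier v)
      (MKdV.xFourier w)) ≤ _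
    generalize MKdV.xFourier u = a
    generalize MKdV.xFourier v = b
    generalize MKdV.xFourier w = c
    by_cases h0 : MKdV.YNorm lam s a = 0 ∨ MKdV.YNorm lam s b = 0 ∨ MKdV.YNorm lam s c = 0
    · rw [MKdV.ZNorm_trilinear_eq_zero hl0 h0]
      exact zero_le
    simp only [not_or] at h0
    have hK : ENNReal.ofReal (C * lam ^ ε) ≠ 0 := (ENNReal.ofReal_pos.2 (by positivity)).ne'
    by_cases ht : MKdV.YNorm lam s a = ∞ ∨ MKdV.YNorm lam s b = ∞ ∨ MKdV.YNorm lam s c = ∞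
    · have : ENNReal.ofReal (C * lam ^ ε) * MKdV.YNorm lam s a * MKdV.YNorm lam s b *
          MKdV.YNorm lam s c = ∞ := by
        rcases ht with ht | ht | ht <;> simp [ht, h0, hK, ENNReal.top_mul]
      rw [this]
      exact le_top
    simp only [not_or, ← lt_top_iff_ne_top] at ht
    refine (h lam s hl hs a b c ht.1 ht.2.1 ht.2.2).trans ?_
    gcongr
    exact min_le_left _ _
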